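/- Let $K$ be a compact subset of $\mathbb R^d$ and let $\mathcal P(K)$ be the set of Borel probability measures on $K$, endowed with the weak topology. For $\mu\in\mathcal P(K)$, $x\in K$ and $\alpha,q\in\mathbb R$, let $B(x,r)$ be the open ball in $K$ with center $x$ and radius $r$, and set $$\underline{\dim}_{\rm loc}(\mu;x)=\liminf_{r\to0^+}\frac{\log\mu(B(x,r))}{\log r},\qquad E_-(\mu;\alpha)=\{x\in K:\ \underline{\dim}_{\rm loc}(\mu;x)=\alpha\},$$ $$\underline D_\mu(q)=\liminf_{r\to0^+}\frac{\log\int_K\mu(B(x,r))^{q-1}\,d\mu(x)}{\log r}\in[-\infty,+\infty],\qquad (\underline D_\mu)^*(\alpha)=\inf_{q\in\mathbb R}\big(q\alpha-\underline D_\mu(q)\big),$$ where $\log 0=-\infty$ (so the lower local dimension is $+\infty$ outside the support of $\mu$). Let $\dim_{\mathcal H}$ denote the Hausdorff dimension, with $\dim_{\mathcal H}(\varnothing)=0$. Then a typical $\mu\in\mathcal P(K)$ satisfies the multifractal formalism on $[0,\dim_{\mathcal H}(K))$: there is a dense $G_\delta$ subset $\mathcal R$ of $\mathcal P(K)$ such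 that, for every $\mu\in\mathcal R$, $$\dim_{\mathcal H}\big(E_-(\mu;\alpha)\big)=(\underline D_\mu)^*(\alpha)\qquad\text{for every real }\alpha\in[0,\dim_{\mathcal H}(K)).$$ -/

import Mathlib

open MeasureTheory Topology Filter

noncomputable section

namespace Multifractal

/-- A property holds for a typical point of `X` if it is satisfied on a dense `G_δ` set. -/
def Typical {X : Type*} [TopologicalSpace X] (p : X → Prop) : Prop :=
  ∃ S : Set X, IsGδ S ∧ Dense S ∧ ∀ x ∈ S, p x

variable {X : Type*} [PseudoMetricSpace X] [MeasurableSpace X]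

/-- The lower local dimension `liminf_{r → 0+} log μ(B(x,r)) / log r`, with values in `EReal`.
Here `log 0 = -∞`, so that the value is `+∞` at the points outside the support of `μ`. -/
def lowerLocalDim (μ : Measure X) (x : X) : EReal :=
  liminf (fun r : ℝ => ENNReal.log (μ (Metric.ball x r)) / ((Real.log r : ℝ) : EReal)) (𝓝[>] 0)

/-- The level set `E_-(μ; α)` of the lower local dimension. -/
def lowerLevelSet (μ : Measure X) (α : ℝ) : Set X :=
  {x | lowerLocalDim μ x = (α : EReal)}

/-- The lower `L^q`-spectrum `liminf_{r → 0+} log (∫ μ(B(x,r))^(q-1) dμ(x)) / log r`,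
with values in `EReal`. -/
def lowerLqSpectrum (μ : Measure X) (q : ℝ) : EReal :=
  liminf (fun r : ℝ =>
    ENNReal.log (∫⁻ x, (μ (Metric.ball x r)) ^ (q - 1) ∂μ) / ((Real.log r : ℝ) : EReal)) (𝓝[>] 0)

/-- The Legendre transform `f^*(α) = inf_{q ∈ ℝ} (q α - f(q))` of `f : ℝ → [-∞, +∞]`. -/
def legendreTransform (f : ℝ → EReal) (α : ℝ) : EReal :=
  ⨅ q : ℝ, (((q * α : ℝ) : EReal) - f q)

end Multifractal

end

noncomputable section

namespace Multifractal

open scoped ENNReal NNReal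

/-! For a typical `μ`, both sides of the formula equal `α`.

For the Legendre transform it suffices that the `L^q`-spectrum lies below the line `(q - 1) α`,
which it meets at `q = 1`. For `q < 1` this holds because, for each rational `a` between `α` and
`dimH K`, a typical `μ` gives at some small scales `r` an almost non-negligible mass to points whose
`r`-balls have mass at most `r ^ a` (`dense_spreadOut`). For `q ≥ 1` it holds because there are
points of arbitrarily small lower local dimension.

For the dimension, a Vitali covering shows that the points of lower local dimension less than `α`
form an `α`-null set. Hence it is enough to have a set of positive `α`-measure on which the lower
local dimension is at most `α`: its trace on the level set still has positive measure
(`le_dimH_lowerLevelSet`). If `F` is null in dimension `b`, point masses at the centres of an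
economical cover, added in small proportion to any measure, force the local dimension to be at most
`b` on `F` (`dense_heavyCover`).

Baire's theorem allows only countably many pairs `(F, b)`, although `α` ranges over an interval;
`exists_countable_family` supplies them. In a binary coding of `K`, a minimal closed set of content
at least one for an `s`-dimensional gauge has arbitrarily fine covers of cost close to one, so it is
null in every dimension larger than `s`. Minimal sets are iterated along rationals decreasing to
`α`. Each stage depends only on a finite list of rationals, and by compactness the intersection
keeps content at least one for `α`. -/

/-! ### Power-law exponents at `0` -/

/-- If `g r ≥ r ^ c` for arbitrarily small `r`, the lower exponent of `g` at `0` is at most `c`. -/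
lemma liminf_log_div_log_le {g : ℝ → ℝ≥0∞} {c : ℝ}
    (h : ∃ᶠ r in 𝓝[>] (0 : ℝ), ENNReal.ofReal (r ^ c) ≤ g r) :
    liminf (fun r : ℝ => ENNReal.log (g r) / ((Real.log r : ℝ) : EReal)) (𝓝[>] 0) ≤ (c : EReal) := by
  apply liminf_le_of_frequently_le'
  have h1 : ∀ᶠ r in 𝓝[>] (0 : ℝ), r ∈ Set.Ioo (0 : ℝ) 1 :=
    Ioo_mem_nhdsGT one_pos
  refine (h.and_eventually h1).mono ?_
  rintro r ⟨hr, hr0, hr1⟩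
  have hlog : Real.log r < 0 := Real.log_neg hr0 hr1
  have h2 := ENNReal.log_le_log hr
  rw [ENNReal.log_ofReal_of_pos (Real.rpow_pos_of_pos hr0 c), Real.log_rpow hr0] at h2
  have h3 := EReal.div_le_div_right_of_nonpos (c := ((Real.log r : ℝ) : EReal))
    (by exact_mod_cast hlog.le) h2
  refine h3.trans (le_of_eq ?_)
  rw [← EReal.coe_div, mul_div_cancel_right₀ _ hlog.ne]

/-- If the lower exponent of `g` at `0` is less than `c`, then `g r ≥ r ^ c` for arbitrarily
small `r`. -/
lemma frequently_le_of_liminf_log_div_log_lt {g : ℝ → ℝ≥0∞} {c : ℝ}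
    (h : liminf (fun r : ℝ => ENNReal.log (g r) / ((Real.log r : ℝ) : EReal)) (𝓝[>] 0) < (c : EReal)) :
    ∃ᶠ r in 𝓝[>] (0 : ℝ), ENNReal.ofReal (r ^ c) ≤ g r := by
  have h0 := frequently_lt_of_liminf_lt (by isBoundedDefault) h
  have h1 : ∀ᶠ r in 𝓝[>] (0 : ℝ), r ∈ Set.Ioo (0 : ℝ) 1 :=
    Ioo_mem_nhdsGT one_pos
  refine (h0.and_eventually h1).mono ?_
  rintro r ⟨hr, hr0, hr1⟩
  have hlog : Real.log r < 0 := Real.log_neg hr0 hr1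
  by_contra hcon
  push Not at hcon
  have h2 := ENNReal.log_le_log hcon.le
  rw [ENNReal.log_ofReal_of_pos (Real.rpow_pos_of_pos hr0 c), Real.log_rpow hr0] at h2
  have h3 := EReal.div_le_div_right_of_nonpos (c := ((Real.log r : ℝ) : EReal))
    (by exact_mod_cast hlog.le) h2
  rw [← EReal.coe_div, mul_div_cancel_right₀ _ hlog.ne] at h3
  exact absurd hr (not_lt.2 h3)

lemma frequently_nhdsGT_zero {p : ℝ → Prop} (h : ∀ ε > 0, ∃ r, 0 < r ∧ r < ε ∧ p r) :
    ∃ᶠ r in 𝓝[>] (0 : ℝ), p r := by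
  rw [(nhdsGT_basis (0 : ℝ)).frequently_iff]
  intro ε hε
  obtain ⟨r, h1, h2, h3⟩ := h ε hε
  exact ⟨r, ⟨h1, h2⟩, h3⟩

lemma exists_of_frequently_nhdsGT_zero {p : ℝ → Prop} (h : ∃ᶠ r in 𝓝[>] (0 : ℝ), p r)
    {ε : ℝ} (hε : 0 < ε) : ∃ r, 0 < r ∧ r < ε ∧ p r := by
  obtain ⟨r, hr, h3⟩ := (nhdsGT_basis (0 : ℝ)).frequently_iff.1 h ε hε
  exact ⟨r, hr.1, hr.2, h3⟩

/-! ### Hausdorff dimension of the level sets: upper bound -/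

/-- A countable cover by closed balls, indexed by a set, bounds Hausdorff measures. -/
lemma hausdorffMeasure_eq_zero_of_closedBall_covers {X : Type*} [MetricSpace X]
    [MeasurableSpace X] [BorelSpace X] {s : Set X} {a : ℝ} (ha : 0 < a)
    (h : ∀ ε : ℝ, 0 < ε → ∃ (W : Set (X × ℝ)), W.Countable ∧ (∀ p ∈ W, 0 < p.2 ∧ p.2 < ε) ∧
      s ⊆ ⋃ p ∈ W, Metric.closedBall p.1 p.2 ∧
      ∑' p : W, ENNReal.ofReal ((p : X × ℝ).2 ^ a) ≤ ENNReal.ofReal ε) : μH[a] s = 0 := by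
  rw [← nonpos_iff_eq_zero]
  have key : ∀ n : ℕ, ∃ (W : Set (X × ℝ)), W.Countable ∧ (∀ p ∈ W, 0 < p.2 ∧ p.2 < 1 / ((n : ℝ) + 1)) ∧
      s ⊆ ⋃ p ∈ W, Metric.closedBall p.1 p.2 ∧
      ∑' p : W, ENNReal.ofReal ((p : X × ℝ).2 ^ a) ≤ ENNReal.ofReal (1 / ((n : ℝ) + 1)) :=
    fun n => h _ (by positivity)
  choose W hW hr hs hsum using key
  have : ∀ n, Countable (W n) := fun n => (hW n).to_subtype
  have hdiam : ∀ (n : ℕ) (p : W n), Metric.ediam (Metric.closedBall (p : X × ℝ).1 (p : X × ℝ).2)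
      ≤ 2 * ENNReal.ofReal (p : X × ℝ).2 := fun n p => by
    refine Metric.ediam_le fun x hx y hy => ?_
    rw [edist_dist, ← ENNReal.ofReal_ofNat, ← ENNReal.ofReal_mul (by norm_num)]
    apply ENNReal.ofReal_le_ofReal
    have := dist_triangle_right x y (p : X × ℝ).1
    rw [Metric.mem_closedBall] at hx hy
    linarith
  have hlim : Tendsto (fun n : ℕ => ENNReal.ofReal (1 / ((n : ℝ) + 1))) atTop (𝓝 0) := by
    have := (ENNReal.continuous_ofReal.tendsto 0).comp tendsto_one_div_add_atTop_nhds_zero_nat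
    simpa [Function.comp_def] using this
  have hlim2 : ∀ c : ℝ≥0∞, c ≠ ∞ →
      Tendsto (fun n : ℕ => c * ENNReal.ofReal (1 / ((n : ℝ) + 1))) atTop (𝓝 0) := fun c hc => by
    simpa using ENNReal.Tendsto.const_mul hlim (Or.inr hc)
  refine (Measure.hausdorffMeasure_le_liminf_tsum (ι := fun n => W n) a s _ (hlim2 2 (by simp))
    (fun n p => Metric.closedBall (p : X × ℝ).1 (p : X × ℝ).2) ?_ ?_).trans ?_
  · refine Eventually.of_forall fun n p => (hdiam n p).trans ?_
    gcongr
    exact (hr n p p.2).2.le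
  · refine Eventually.of_forall fun n => (hs n).trans ?_
    rw [Set.biUnion_eq_iUnion]
  · have hb : ∀ n, ∑' p : W n, Metric.ediam (Metric.closedBall (p : X × ℝ).1 (p : X × ℝ).2) ^ a ≤
        2 ^ a * ENNReal.ofReal (1 / ((n : ℝ) + 1)) := fun n => by
      calc _ ≤ ∑' p : W n, 2 ^ a * ENNReal.ofReal ((p : X × ℝ).2 ^ a) := by
            refine ENNReal.tsum_le_tsum fun p => ?_
            rw [← ENNReal.ofReal_rpow_of_pos (hr n p p.2).1, ← ENNReal.mul_rpow_of_nonneg _ _ ha.le]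
            exact ENNReal.rpow_le_rpow (hdiam n p) ha.le
        _ ≤ _ := by
            rw [ENNReal.tsum_mul_left]
            gcongr
            exact hsum n
    refine (liminf_le_liminf (Eventually.of_forall hb)).trans ?_
    rw [(hlim2 (2 ^ a) (ENNReal.rpow_ne_top_of_nonneg ha.le (by simp))).liminf_eq]

/-- Upper bound in the mass distribution principle: the set of points where the lower local
dimension is less than `b` is null for the Hausdorff measures of larger dimension. -/
lemma hausdorffMeasure_lowerLocalDim_lt {X : Type*} [MetricSpace X] [MeasurableSpace X]
    [BorelSpace X] (μ : Measure X) [IsProbabilityMeasure μ] {a b : ℝ} (ha : 0 < a) (hab : b < a) :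
    μH[a] {x | lowerLocalDim μ x < (b : EReal)} = 0 := by
  set A := {x | lowerLocalDim μ x < (b : EReal)} with hA
  apply hausdorffMeasure_eq_zero_of_closedBall_covers ha
  intro ε hε
  have hpos : 0 < a - b := sub_pos.2 hab
  -- The factor 5 is the Vitali enlargement. Since `(5 r) ^ a = 5 ^ a * r ^ (a - b) * r ^ b`, the
  -- second bound leaves at most `ε` times the sum of the `r ^ b`.
  obtain ⟨δ, hδ, hδ5, hδε⟩ : ∃ δ : ℝ, 0 < δ ∧ 5 * δ < ε ∧ 5 ^ a * δ ^ (a - b) ≤ ε := by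
    refine ⟨min (ε / 10) ((ε / 5 ^ a) ^ (1 / (a - b))), by positivity, ?_, ?_⟩
    · have := min_le_left (ε / 10) ((ε / 5 ^ a) ^ (1 / (a - b)))
      linarith
    · have h1 := min_le_right (ε / 10) ((ε / 5 ^ a) ^ (1 / (a - b)))
      have h2 := Real.rpow_le_rpow (by positivity) h1 hpos.le
      rw [← Real.rpow_mul (by positivity), one_div_mul_cancel hpos.ne', Real.rpow_one] at h2
      calc _ ≤ (5 : ℝ) ^ a * (ε / 5 ^ a) := by gcongr
        _ = ε := by field_simp
  have hex : ∀ x ∈ A, ∃ r, 0 < r ∧ r < δ ∧ ENNReal.ofReal (r ^ b) ≤ μ (Metric.ball x r) :=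
    fun x hx => exists_of_frequently_nhdsGT_zero
      (frequently_le_of_liminf_log_div_log_lt (g := fun r => μ (Metric.ball x r)) hx) hδ
  choose! r hr0 hrδ hr using hex
  obtain ⟨u, huA, hdisj, hcov⟩ := Vitali.exists_disjoint_subfamily_covering_enlargement_closedBall
    A (fun x => x) r δ (fun x hx => (hrδ x hx).le) 5 (by norm_num)
  have hmeas : ∀ x : u, MeasurableSet (Metric.ball (x : X) (r x)) :=
    fun x => Metric.isOpen_ball.measurableSet
  have hdisj' : Pairwise (Function.onFun Disjoint fun x : u => Metric.ball (x : X) (r x)) :=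
    fun x y hxy => (hdisj x.2 y.2 (fun h => hxy (Subtype.ext h))).mono
      Metric.ball_subset_closedBall Metric.ball_subset_closedBall
  -- Each selected ball has mass at least `r ^ b` and the balls are disjoint. Summability of
  -- positive terms then makes the subfamily countable.
  have hsum : ∑' x : u, ENNReal.ofReal (r x ^ b) ≤ 1 := by
    calc _ ≤ ∑' x : u, μ (Metric.ball (x : X) (r x)) :=
          ENNReal.tsum_le_tsum fun x => hr x (huA x.2)
      _ ≤ μ Set.univ := tsum_meas_le_meas_iUnion_of_disjoint μ hmeas hdisj' |>.trans
          (measure_mono (Set.subset_univ _))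
      _ = 1 := measure_univ
  have hcount : u.Countable := by
    have h := Summable.countable_support_ennreal (f := fun x : u => ENNReal.ofReal (r x ^ b))
      (hsum.trans_lt ENNReal.one_lt_top).ne
    have hsupp : Function.support (fun x : u => ENNReal.ofReal (r x ^ b)) = Set.univ := by
      ext x
      simp [Real.rpow_pos_of_pos (hr0 x (huA x.2)) b]
    rw [hsupp, Set.countable_univ_iff] at h
    exact Set.countable_coe_iff.1 h
  have hinj : Set.InjOn (fun x => (x, 5 * r x)) u := fun x _ y _ h => (Prod.ext_iff.1 h).1
  refine ⟨(fun x => (x, 5 * r x)) '' u, hcount.image _, ?_, ?_, ?_⟩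
  · rintro _ ⟨x, hx, rfl⟩
    have h1 := hr0 x (huA hx)
    have h2 := hrδ x (huA hx)
    exact ⟨by positivity, by dsimp only; linarith⟩
  · intro x hx
    obtain ⟨y, hy, hxy⟩ := hcov x hx
    rw [Set.biUnion_image]
    exact Set.mem_biUnion hy (hxy (Metric.mem_closedBall_self (hr0 x hx).le))
  · rw [tsum_image (fun p : X × ℝ => ENNReal.ofReal (p.2 ^ a)) hinj]
    calc ∑' x : u, ENNReal.ofReal ((5 * r x) ^ a)
        ≤ ∑' x : u, ENNReal.ofReal ε * ENNReal.ofReal (r x ^ b) := by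
          refine ENNReal.tsum_le_tsum fun x => ?_
          rw [← ENNReal.ofReal_mul hε.le]
          apply ENNReal.ofReal_le_ofReal
          have h1 := hr0 x (huA x.2)
          have h2 := hrδ x (huA x.2)
          calc (5 * r x) ^ a = 5 ^ a * r x ^ (a - b) * r x ^ b := by
                rw [Real.mul_rpow (by norm_num) h1.le, mul_assoc, ← Real.rpow_add h1]
                ring_nf
            _ ≤ 5 ^ a * δ ^ (a - b) * r x ^ b := by gcongr
            _ ≤ ε * r x ^ b := by gcongr
      _ ≤ ENNReal.ofReal ε := by
          rw [ENNReal.tsum_mul_left]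
          exact mul_le_of_le_one_right (by simp) hsum

/-- A strict inequality leaves room for a rational, so the set is a countable union of sets that are
null by the preceding lemma. Nullity at the exponent `a` itself is what the lower bound on the
dimension needs. -/
lemma hausdorffMeasure_lowerLocalDim_lt_self {X : Type*} [MetricSpace X] [MeasurableSpace X]
    [BorelSpace X] (μ : Measure X) [IsProbabilityMeasure μ] {a : ℝ} (ha : 0 < a) :
    μH[a] {x | lowerLocalDim μ x < (a : EReal)} = 0 := by
  have hsub : {x | lowerLocalDim μ x < (a : EReal)} ⊆
      ⋃ q : {q : ℚ // (q : ℝ) < a}, {x | lowerLocalDim μ x < (((q : ℚ) : ℝ) : EReal)} := by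
    intro x hx
    obtain ⟨q, hq1, hq2⟩ := EReal.lt_iff_exists_rat_btwn.1 hx
    exact Set.mem_iUnion.2 ⟨⟨q, by exact_mod_cast hq2⟩, hq1⟩
  exact measure_mono_null hsub (measure_iUnion_null fun q => hausdorffMeasure_lowerLocalDim_lt μ ha q.2)

lemma dimH_lowerLevelSet_le {X : Type*} [MetricSpace X] [MeasurableSpace X]
    [BorelSpace X] (μ : Measure X) [IsProbabilityMeasure μ] {a : ℝ} (ha : 0 ≤ a) :
    dimH (lowerLevelSet μ a) ≤ ENNReal.ofReal a := by
  refine le_of_forall_gt fun c hc => ?_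
  obtain ⟨d, hd1, hd2⟩ := ENNReal.lt_iff_exists_nnreal_btwn.1 hc
  refine lt_of_le_of_lt ?_ hd2
  have had : a < d := by
    rw [← ENNReal.ofReal_coe_nnreal, ENNReal.ofReal_lt_ofReal_iff'] at hd1
    exact hd1.1
  apply dimH_le_of_hausdorffMeasure_ne_top
  rw [measure_mono_null (t := {x | lowerLocalDim μ x < ((d : ℝ) : EReal)}) _
    (hausdorffMeasure_lowerLocalDim_lt_self μ (ha.trans_lt had))]
  · simp
  · intro x hx
    change lowerLocalDim μ x = a at hx
    change lowerLocalDim μ x < _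
    rw [hx]
    exact_mod_cast had

/-! ### Null sets in terms of finite covers by balls -/

/-- A set is ball-null in dimension `s` if it has finite covers by small balls with arbitrarily
small sum of the `s`-th powers of the radii. -/
def BallNull {X : Type*} [PseudoMetricSpace X] (s : ℝ) (F : Set X) : Prop :=
  ∀ ε : ℝ, 0 < ε → ∃ W : Finset (X × ℝ), (∀ p ∈ W, 0 < p.2 ∧ p.2 < ε) ∧
    F ⊆ ⋃ p ∈ W, Metric.ball p.1 p.2 ∧ ∑ p ∈ W, p.2 ^ s < ε

lemma BallNull.hausdorffMeasure_eq_zero {X : Type*} [MetricSpace X] [MeasurableSpace X]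
    [BorelSpace X] {s : ℝ} {F : Set X} (hs : 0 < s) (h : BallNull s F) : μH[s] F = 0 := by
  apply hausdorffMeasure_eq_zero_of_closedBall_covers hs
  intro ε hε
  obtain ⟨W, hW, hc, hsum⟩ := h ε hε
  refine ⟨W, W.countable_toSet, hW, hc.trans ?_, ?_⟩
  · exact Set.iUnion₂_mono fun p _ => Metric.ball_subset_closedBall
  · rw [Finset.tsum_subtype' W (fun p : X × ℝ => ENNReal.ofReal (p.2 ^ s)),
      ← ENNReal.ofReal_sum_of_nonneg fun p hp => Real.rpow_nonneg (hW p hp).1.le s]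
    exact ENNReal.ofReal_le_ofReal hsum.le

/-- Each nonempty set of an economical cover lies in an open ball centred at one of its points, with
radius slightly larger than its diameter. The excess is paid for by a summable sequence `c`, and
compactness extracts a finite subcover. -/
lemma ballNull_of_hausdorffMeasure_eq_zero {X : Type*} [MetricSpace X] [MeasurableSpace X]
    [BorelSpace X] {s : ℝ} {F : Set X} (hF : IsCompact F) (hs : 0 < s) (h : μH[s] F = 0) :
    BallNull s F := by
  intro ε hε
  rw [Measure.hausdorffMeasure_apply] at h
  simp only [ENNReal.iSup_eq_zero] at h
  have h1 := h (ENNReal.ofReal (ε / 2)) (by simpa using hε)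
  have h2 : (0 : ℝ≥0∞) < ENNReal.ofReal (ε / 2) := by simpa using hε
  obtain ⟨t, ht, hd, hsum⟩ : ∃ t : ℕ → Set X, F ⊆ ⋃ n, t n ∧
      (∀ n, Metric.ediam (t n) ≤ ENNReal.ofReal (ε / 2)) ∧
      ∑' n, (⨆ _ : (t n).Nonempty, Metric.ediam (t n) ^ s) < ENNReal.ofReal (ε / 2) := by
    rw [← h1] at h2
    simpa only [iInf_lt_iff, exists_prop] using h2
  obtain ⟨c, hc, hcε⟩ := ENNReal.exists_pos_sum_of_countable' h2.ne' ℕ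
  have hρ : ∀ n, ∃ ρ : ℝ, 0 < ρ ∧ Metric.ediam (t n) < ENNReal.ofReal ρ ∧ ρ < ε ∧
      ENNReal.ofReal (ρ ^ s) < Metric.ediam (t n) ^ s + c n := by
    intro n
    have hfin : Metric.ediam (t n) ≠ ∞ := ((hd n).trans_lt ENNReal.ofReal_lt_top).ne
    set D := (Metric.ediam (t n)).toReal with hD
    have hDn : Metric.ediam (t n) = ENNReal.ofReal D := (ENNReal.ofReal_toReal hfin).symm
    have hD0 : 0 ≤ D := ENNReal.toReal_nonneg
    have hDε : D < ε := by
      have := hd n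
      rw [hDn, ENNReal.ofReal_le_ofReal_iff (by positivity)] at this
      linarith
    have hcont : Tendsto (fun ρ : ℝ => ENNReal.ofReal (ρ ^ s)) (𝓝[>] D)
        (𝓝 (ENNReal.ofReal (D ^ s))) :=
      ((ENNReal.continuous_ofReal.tendsto _).comp
        ((Real.continuousAt_rpow_const D s (Or.inr hs.le)).tendsto)).mono_left nhdsWithin_le_nhds
    have hlt : ENNReal.ofReal (D ^ s) < Metric.ediam (t n) ^ s + c n := by
      rw [hDn, ENNReal.ofReal_rpow_of_nonneg hD0 hs.le]
      exact ENNReal.lt_add_right (by simp) (hc n).ne'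
    obtain ⟨ρ, hρ1, hρ2, hρ3⟩ := ((hcont.eventually (gt_mem_nhds hlt)).and
      (Ioo_mem_nhdsGT hDε)).exists
    have hρ0 : 0 < ρ := hD0.trans_lt hρ2
    refine ⟨ρ, hρ0, ?_, hρ3, hρ1⟩
    rw [hDn]
    exact (ENNReal.ofReal_lt_ofReal_iff hρ0).2 hρ2
  choose ρ hρ0 hρd hρε hρs using hρ
  have hx : ∀ n : {n // (t n).Nonempty}, ∃ x, x ∈ t n := fun n => n.2
  choose x hx using hx
  obtain ⟨f, hf⟩ := hF.elim_finite_subcover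
    (fun n : {n // (t n).Nonempty} => Metric.ball (x n) (ρ n)) (fun n => Metric.isOpen_ball) (by
      intro y hy
      obtain ⟨n, hn⟩ := Set.mem_iUnion.1 (ht hy)
      refine Set.mem_iUnion.2 ⟨⟨n, y, hn⟩, ?_⟩
      rw [Metric.mem_ball, ← ENNReal.ofReal_lt_ofReal_iff (hρ0 n), ← edist_dist]
      exact (Metric.edist_le_ediam_of_mem hn (hx ⟨n, y, hn⟩)).trans_lt (hρd n))
  classical
  refine ⟨f.image fun n => (x n, ρ n), ?_, ?_, ?_⟩
  · intro p hp
    obtain ⟨n, -, rfl⟩ := Finset.mem_image.1 hp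
    exact ⟨hρ0 n, hρε n⟩
  · refine hf.trans (Set.iUnion₂_subset fun n hn => ?_)
    exact Set.subset_biUnion_of_mem (u := fun p : X × ℝ => Metric.ball p.1 p.2)
      (Finset.mem_coe.2 (Finset.mem_image_of_mem (fun n : {n // (t n).Nonempty} => (x n, ρ n)) hn))
  · refine (Finset.sum_image_le_of_nonneg (g := fun n : {n // (t n).Nonempty} => (x n, ρ n))
      (f := fun p : X × ℝ => p.2 ^ s) fun p hp => ?_).trans_lt ?_
    · obtain ⟨n, -, rfl⟩ := Finset.mem_image.1 hp
      exact Real.rpow_nonneg (hρ0 n).le s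
    change ∑ n ∈ f, ρ n ^ s < ε
    rw [← ENNReal.ofReal_lt_ofReal_iff hε,
      ENNReal.ofReal_sum_of_nonneg (f := fun n : {n // (t n).Nonempty} => ρ n ^ s)
        fun n _ => Real.rpow_nonneg (hρ0 n).le s]
    calc ∑ n ∈ f, ENNReal.ofReal (ρ n ^ s)
        ≤ ∑ n ∈ f, ((⨆ _ : (t n).Nonempty, Metric.ediam (t n) ^ s) + c n) := by
          refine Finset.sum_le_sum fun n _ => ?_
          rw [ciSup_pos n.2]
          exact (hρs n).le
      _ ≤ ∑' n : {n // (t n).Nonempty}, ((⨆ _ : (t n).Nonempty, Metric.ediam (t n) ^ s) + c n) :=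
          ENNReal.sum_le_tsum f
      _ ≤ ∑' n : ℕ, ((⨆ _ : (t n).Nonempty, Metric.ediam (t n) ^ s) + c n) :=
          ENNReal.tsum_comp_le_tsum_of_injective Subtype.val_injective _
      _ = ∑' n : ℕ, (⨆ _ : (t n).Nonempty, Metric.ediam (t n) ^ s) + ∑' n, c n := ENNReal.tsum_add
      _ < ENNReal.ofReal (ε / 2) + ENNReal.ofReal (ε / 2) := ENNReal.add_lt_add hsum hcε
      _ = ENNReal.ofReal ε := by
          rw [← ENNReal.ofReal_add (by positivity) (by positivity), add_halves]

lemma not_ballNull_of_lt_dimH {X : Type*} [MetricSpace X] {s : ℝ} {F : Set X} (hs : 0 < s)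
    (h : ENNReal.ofReal s < dimH F) : ¬ BallNull s F := by
  borelize X
  intro hnull
  have h1 := dimH_le_of_hausdorffMeasure_ne_top (d := s.toNNReal) (s := F) (by
    rw [Real.coe_toNNReal _ hs.le, hnull.hausdorffMeasure_eq_zero hs]
    simp)
  exact absurd h (not_lt.2 h1)

lemma exists_real_btwn {a : ℝ} {c : ℝ≥0∞} (h : ENNReal.ofReal a < c) :
    ∃ s : ℝ, a < s ∧ ENNReal.ofReal s < c := by
  obtain ⟨s, hs1, hs2⟩ := ENNReal.lt_iff_exists_nnreal_btwn.1 h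
  refine ⟨s, ?_, by simpa using hs2⟩
  rw [← ENNReal.ofReal_coe_nnreal, ENNReal.ofReal_lt_ofReal_iff'] at hs1
  exact hs1.1

/-! ### Minimal closed sets of content at least one in a sequence space -/

section Cylinders

open PiNat

variable {A : Type*}

/-- The finite family `W` of cylinders covers `E`. -/
def CylCover (W : Finset ((ℕ → A) × ℕ)) (E : Set (ℕ → A)) : Prop :=
  E ⊆ ⋃ p ∈ W, cylinder p.1 p.2

/-- The cost of a finite family of cylinders for the gauge `g` of the level. -/
def cylCost (g : ℕ → ℝ) (W : Finset ((ℕ → A) × ℕ)) : ℝ := ∑ p ∈ W, g p.2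

/-- The content of `E` for the gauge `g` is at least one. -/
def IsBig (g : ℕ → ℝ) (E : Set (ℕ → A)) : Prop := ∀ W, CylCover W E → 1 ≤ cylCost g W

lemma IsBig.mono_gauge {g g' : ℕ → ℝ} {E : Set (ℕ → A)} (h : IsBig g E) (hg : ∀ n, g n ≤ g' n) :
    IsBig g' E := fun W hW => (h W hW).trans (Finset.sum_le_sum fun p _ => hg p.2)

open Classical in
lemma cylCost_union_le {g : ℕ → ℝ} (hg : ∀ n, 0 ≤ g n) (W W' : Finset ((ℕ → A) × ℕ)) :
    cylCost g (W ∪ W') ≤ cylCost g W + cylCost g W' := by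
  unfold cylCost
  rw [← Finset.sum_union_inter]
  exact le_add_of_nonneg_right (Finset.sum_nonneg fun p _ => hg p.2)

open Classical in
lemma CylCover.union {W W' : Finset ((ℕ → A) × ℕ)} {E E' : Set (ℕ → A)} (h : CylCover W E)
    (h' : CylCover W' E') : CylCover (W ∪ W') (E ∪ E') := by
  rintro x (hx | hx)
  · obtain ⟨p, hp, hxp⟩ := Set.mem_iUnion₂.1 (h hx)
    exact Set.mem_iUnion₂.2 ⟨p, Finset.mem_union_left _ hp, hxp⟩
  · obtain ⟨p, hp, hxp⟩ := Set.mem_iUnion₂.1 (h' hx)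
    exact Set.mem_iUnion₂.2 ⟨p, Finset.mem_union_right _ hp, hxp⟩

open Classical in
lemma cylCost_biUnion_le {g : ℕ → ℝ} (hg : ∀ n, 0 ≤ g n) {ι : Type*} (W : Finset ι)
    (R : ι → Finset ((ℕ → A) × ℕ)) : cylCost g (W.biUnion R) ≤ ∑ p ∈ W, cylCost g (R p) := by
  induction W using Finset.induction_on with
  | empty => simp [cylCost]
  | insert p W hp ih =>
    rw [Finset.biUnion_insert, Finset.sum_insert hp]
    exact (cylCost_union_le hg _ _).trans (by gcongr)

lemma cylCover_singleton (x : ℕ → A) (n : ℕ) : CylCover {(x, n)} (cylinder x n) := by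
  simp [CylCover]

lemma cylCost_singleton (g : ℕ → ℝ) (x : ℕ → A) (n : ℕ) : cylCost g {(x, n)} = g n := by
  simp [cylCost]

lemma CylCover.mono {W : Finset ((ℕ → A) × ℕ)} {E E' : Set (ℕ → A)} (h : CylCover W E)
    (h' : E' ⊆ E) : CylCover W E' := h'.trans h

/-- A minimal set among closed sets of content at least one. -/
structure IsMinimalBig [TopologicalSpace A] (g : ℕ → ℝ) (E : Set (ℕ → A)) : Prop where
  isClosed : IsClosed E
  isBig : IsBig g E
  not_isBig : ∀ E' ⊆ E, IsClosed E' → E' ≠ E → ¬ IsBig g E'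

variable [TopologicalSpace A] [DiscreteTopology A]

lemma isOpen_biUnion_cylinder (W : Finset ((ℕ → A) × ℕ)) :
    IsOpen (⋃ p ∈ W, cylinder p.1 p.2) :=
  isOpen_biUnion fun p _ => isOpen_cylinder (fun _ => A) p.1 p.2

/-- A union of cylinders is open, so by compactness a cover of the intersection already covers some
`V i`. This passage to the limit underlies both Zorn's lemma and the final intersection over
exponents. -/
lemma isBig_iInter [Finite A] {g : ℕ → ℝ} {ι : Type*} [Nonempty ι] {V : ι → Set (ℕ → A)}
    (hdir : Directed (· ⊇ ·) V) (hcl : ∀ i, IsClosed (V i)) (hbig : ∀ i, IsBig g (V i)) :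
    IsBig g (⋂ i, V i) := by
  intro W hW
  obtain ⟨i, hi⟩ := exists_subset_nhds_of_isCompact' hdir (fun i => (hcl i).isCompact) hcl
    (fun x hx => (isOpen_biUnion_cylinder W).mem_nhds (hW hx))
  exact hbig i W hi

lemma exists_isMinimalBig [Finite A] {g : ℕ → ℝ} {E : Set (ℕ → A)} (hE : IsClosed E)
    (hbig : IsBig g E) : ∃ E' ⊆ E, IsMinimalBig g E' := by
  obtain ⟨m, hmE, hm⟩ := zorn_superset_nonempty {F : Set (ℕ → A) | IsClosed F ∧ IsBig g F}
    (fun c hc hchain hne => by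
      have : Nonempty c := hne.to_subtype
      refine ⟨⋂ i : c, (i : Set (ℕ → A)), ⟨isClosed_iInter fun i => (hc i.2).1,
        isBig_iInter ?_ (fun i => (hc i.2).1) (fun i => (hc i.2).2)⟩,
        fun s hs => Set.iInter_subset (fun i : c => (i : Set (ℕ → A))) ⟨s, hs⟩⟩
      intro i j
      rcases hchain.total i.2 j.2 with h | h
      · exact ⟨i, subset_rfl, h⟩
      · exact ⟨j, h, subset_rfl⟩) E ⟨hE, hbig⟩
  refine ⟨m, hmE, hm.prop.1, hm.prop.2, fun E' hE' hcl hne hb => hne ?_⟩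
  exact hE'.antisymm (hm.le_of_le ⟨hcl, hb⟩ hE')

variable {g : ℕ → ℝ} {E : Set (ℕ → A)}

/-- Removing a cylinder that meets a minimal set makes the content less than one. -/
lemma IsMinimalBig.exists_cover_diff (hE : IsMinimalBig g E) {x : ℕ → A} (hx : x ∈ E) (n : ℕ) :
    ∃ W, CylCover W (E \ cylinder x n) ∧ cylCost g W < 1 := by
  have := hE.not_isBig (E \ cylinder x n) Set.sdiff_subset
    (hE.isClosed.sdiff (isOpen_cylinder (fun _ => A) x n)) (fun h => by
      rw [← h] at hx
      exact hx.2 (self_mem_cylinder x n))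
  unfold IsBig at this
  push Not at this
  exact this

open Classical in
-- By minimality, what remains after removing a small cylinder has a cover of cost less than one;
-- putting the cylinder back costs less than `ε`.
lemma IsMinimalBig.exists_cover (hE : IsMinimalBig g E) (hg : ∀ n, 0 < g n)
    (hg0 : Tendsto g atTop (𝓝 0)) {ε : ℝ} (hε : 0 < ε) : ∃ W, CylCover W E ∧ cylCost g W < 1 + ε := by
  obtain ⟨x, hx⟩ : E.Nonempty := by
    by_contra h
    rw [Set.not_nonempty_iff_eq_empty] at h
    have := hE.isBig ∅ (by simp [CylCover, h])
    norm_num [cylCost] at this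
  obtain ⟨n, hn⟩ := (hg0.eventually (gt_mem_nhds hε)).exists
  obtain ⟨W, hW, hc⟩ := hE.exists_cover_diff hx n
  refine ⟨W ∪ {(x, n)}, (hW.union (cylCover_singleton x n)).mono (by simp), ?_⟩
  have := cylCost_union_le (fun n => (hg n).le) W {(x, n)}
  rw [cylCost_singleton] at this
  linarith

open Classical in
/-- In a minimal set, a cylinder can be covered by smaller cylinders at almost no additional
cost. -/
lemma IsMinimalBig.exists_cover_cylinder (hE : IsMinimalBig g E) (hg : ∀ n, 0 < g n)
    (hg0 : Tendsto g atTop (𝓝 0)) (z : ℕ → A) (k : ℕ) {ε : ℝ} (hε : 0 < ε) :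
    ∃ W, CylCover W (E ∩ cylinder z k) ∧ (∀ p ∈ W, k + 1 ≤ p.2) ∧ cylCost g W < g k + ε := by
  by_contra! hcon
  obtain ⟨y, hyE, hyz⟩ : (E ∩ cylinder z k).Nonempty := by
    by_contra h
    rw [Set.not_nonempty_iff_eq_empty] at h
    have := hcon ∅ (by simp [CylCover, h]) (by simp)
    simp only [cylCost, Finset.sum_empty] at this
    linarith [hg k]
  obtain ⟨n, hn, hkn⟩ := ((hg0.eventually (gt_mem_nhds hε)).and (eventually_gt_atTop k)).exists
  obtain ⟨W, hW, hc⟩ := hE.exists_cover_diff hyE n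
  have hsub : cylinder y n ⊆ cylinder z k := by
    rw [← mem_cylinder_iff_eq.1 hyz]
    exact cylinder_anti y hkn.le
  -- A coarse cylinder of `W` meeting `cylinder z k` contains it, hence also the removed cylinder,
  -- so `W` would cover `E` at cost less than one.
  by_cases hlow : ∃ p ∈ W, p.2 ≤ k ∧ (cylinder p.1 p.2 ∩ cylinder z k).Nonempty
  · obtain ⟨p, hpW, hpk, w, hwp, hwz⟩ := hlow
    have hzp : cylinder z k ⊆ cylinder p.1 p.2 := by
      rw [← mem_cylinder_iff_eq.1 hwp, ← mem_cylinder_iff_eq.1 hwz]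
      exact cylinder_anti w hpk
    have hcov : CylCover W E := by
      intro x hx
      by_cases hxy : x ∈ cylinder y n
      · exact Set.mem_biUnion (x := p) hpW (hzp (hsub hxy))
      · exact hW ⟨hx, hxy⟩
    linarith [hE.isBig W hcov]
  · push Not at hlow
    -- Exchange argument: `V` with the removed cylinder is a fine cover of `E ∩ cylinder z k`, so by
    -- `hcon` the cost of `V` exceeds `g k`. Replacing `V` by the single cylinder `(z, k)` then
    -- covers `E` at cost less than one.
    set V := W.filter fun p : (ℕ → A) × ℕ => (cylinder p.1 p.2 ∩ cylinder z k).Nonempty with hV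
    set V' := W.filter fun p : (ℕ → A) × ℕ => ¬ (cylinder p.1 p.2 ∩ cylinder z k).Nonempty with hV'
    have hsplit : cylCost g V + cylCost g V' = cylCost g W :=
      Finset.sum_filter_add_sum_filter_not W _ _
    have h1 := hcon (V ∪ {(y, n)}) (by
      intro x ⟨hx, hxz⟩
      by_cases hxy : x ∈ cylinder y n
      · exact Set.mem_biUnion (x := (y, n)) (by simp) hxy
      · obtain ⟨p, hp, hxp⟩ := Set.mem_iUnion₂.1 (hW ⟨hx, hxy⟩)
        exact Set.mem_biUnion (x := p)
          (Finset.mem_union_left _ (Finset.mem_filter.2 ⟨hp, x, hxp, hxz⟩)) hxp) (by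
      intro p hp
      rcases Finset.mem_union.1 hp with hp | hp
      · obtain ⟨hpW, hpz⟩ := Finset.mem_filter.1 hp
        by_contra hlt
        exact hpz.ne_empty (hlow p hpW (by omega))
      · rw [Finset.mem_singleton.1 hp]
        exact hkn)
    have h2 := cylCost_union_le (fun n => (hg n).le) V {(y, n)}
    rw [cylCost_singleton] at h2
    have h3 := cylCost_union_le (fun n => (hg n).le) V' {(z, k)}
    rw [cylCost_singleton] at h3
    have h4 := hE.isBig (V' ∪ {(z, k)}) (by
      intro x hx
      by_cases hxz : x ∈ cylinder z k
      · exact Set.mem_biUnion (x := (z, k)) (by simp) hxz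
      · obtain ⟨p, hp, hxp⟩ := Set.mem_iUnion₂.1 (hW ⟨hx, fun h => hxz (hsub h)⟩)
        by_cases hpz : (cylinder p.1 p.2 ∩ cylinder z k).Nonempty
        · have hlt : k ≤ p.2 := by
            by_contra hlt
            exact hpz.ne_empty (hlow p hp (by omega))
          obtain ⟨w, hwp, hwz⟩ := hpz
          refine absurd ?_ hxz
          rw [← mem_cylinder_iff_eq.1 hwz]
          rw [← mem_cylinder_iff_eq.1 hwp] at hxp
          exact cylinder_anti w hlt hxp
        · exact Set.mem_biUnion (x := p)
            (Finset.mem_union_left _ (Finset.mem_filter.2 ⟨hp, hpz⟩)) hxp)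
    linarith

open Classical in
/-- A minimal set of content one has covers by arbitrarily small cylinders with cost close to
one. -/
lemma IsMinimalBig.exists_fine_cover (hE : IsMinimalBig g E) (hg : ∀ n, 0 < g n)
    (hg0 : Tendsto g atTop (𝓝 0)) (N : ℕ) : ∀ {ε : ℝ}, 0 < ε →
    ∃ W, CylCover W E ∧ (∀ p ∈ W, N ≤ p.2) ∧ cylCost g W < 1 + ε := by
  induction N with
  | zero =>
    intro ε hε
    obtain ⟨W, hW, hc⟩ := hE.exists_cover hg hg0 hε
    exact ⟨W, hW, by simp, hc⟩
  | succ N ih =>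
    intro ε hε
    obtain ⟨W, hW, hN, hc⟩ := ih (half_pos hε)
    -- Refining every cylinder of `W` once costs at most `ε / 2` in total.
    have hδ : 0 < ε / 2 / (W.card + 1) := by positivity
    choose R hR hRl hRc using fun p : (ℕ → A) × ℕ => hE.exists_cover_cylinder hg hg0 p.1 p.2 hδ
    refine ⟨W.biUnion R, ?_, ?_, ?_⟩
    · intro x hx
      obtain ⟨p, hp, hxp⟩ := Set.mem_iUnion₂.1 (hW hx)
      obtain ⟨q, hq, hxq⟩ := Set.mem_iUnion₂.1 (hR p ⟨hx, hxp⟩)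
      exact Set.mem_biUnion (x := q) (Finset.mem_biUnion.2 ⟨p, hp, hq⟩) hxq
    · intro q hq
      obtain ⟨p, hp, hq⟩ := Finset.mem_biUnion.1 hq
      exact (Nat.succ_le_succ (hN p hp)).trans (hRl p q hq)
    · have h1 : cylCost g (W.biUnion R) ≤ ∑ p ∈ W, cylCost g (R p) :=
        cylCost_biUnion_le (fun n => (hg n).le) W R
      have h2 : ∑ p ∈ W, cylCost g (R p) ≤ ∑ p ∈ W, (g p.2 + ε / 2 / (W.card + 1)) :=
        Finset.sum_le_sum fun p _ => (hRc p).le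
      rw [Finset.sum_add_distrib, Finset.sum_const, nsmul_eq_mul] at h2
      have h3 : (W.card : ℝ) * (ε / 2 / (W.card + 1)) ≤ ε / 2 := by
        rw [mul_div_assoc', div_le_iff₀ (by positivity)]
        nlinarith
      have h4 : ∑ p ∈ W, g p.2 = cylCost g W := rfl
      linarith

end Cylinders

/-! ### Binary coding of a cube -/

/-- The integer whose binary digits are the first `n` terms of `x`. -/
def binaryPrefix (x : ℕ → Fin 2) : ℕ → ℤ
  | 0 => 0
  | n + 1 => 2 * binaryPrefix x n + (x n : ℕ)

lemma eq_of_binaryPrefix_eq {x y : ℕ → Fin 2} {n : ℕ} (h : binaryPrefix x n = binaryPrefix y n) :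
    ∀ i < n, x i = y i := by
  induction n with
  | zero => simp
  | succ n ih =>
    simp only [binaryPrefix] at h
    have hx := (x n).2
    have hy := (y n).2
    intro i hi
    rcases Nat.lt_succ_iff_lt_or_eq.1 hi with hi | rfl
    · exact ih (by omega) i hi
    · ext
      omega

lemma sum_ofDigitsTerm_mul (x : ℕ → Fin 2) (n : ℕ) :
    (∑ i ∈ Finset.range n, Real.ofDigitsTerm x i) * 2 ^ n = binaryPrefix x n := by
  induction n with
  | zero => simp [binaryPrefix]
  | succ n ih =>
    rw [Finset.sum_range_succ, add_mul, pow_succ, ← mul_assoc, ih]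
    simp only [binaryPrefix, Real.ofDigitsTerm]
    push_cast
    field_simp
    ring

lemma binaryPrefix_le (x : ℕ → Fin 2) (n : ℕ) :
    binaryPrefix x n ≤ Real.ofDigits x * 2 ^ n ∧ Real.ofDigits x * 2 ^ n ≤ binaryPrefix x n + 1 := by
  have h0 := Real.ofDigits_nonneg fun i => x (i + n)
  have h1 := Real.ofDigits_le_one fun i => x (i + n)
  rw [Real.ofDigits_eq_sum_add_ofDigits x n, add_mul, sum_ofDigitsTerm_mul]
  have : (((2 : ℕ) : ℝ) ^ n)⁻¹ * Real.ofDigits (fun i => x (i + n)) * 2 ^ n =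
      Real.ofDigits (fun i => x (i + n)) := by
    push_cast
    field_simp
  rw [this]
  constructor <;> linarith

/-- The point of the cube `[-R, R] ^ d` with given binary digits. -/
def cubePoint (d : ℕ) (R : ℝ) (x : ℕ → Fin d → Fin 2) : EuclideanSpace ℝ (Fin d) :=
  WithLp.toLp 2 fun j => R * (2 * Real.ofDigits (fun n => x n j) - 1)

lemma continuous_cubePoint (d : ℕ) (R : ℝ) : Continuous (cubePoint d R) := by
  refine (PiLp.continuous_toLp 2 _).comp (continuous_pi fun j => ?_)
  have : Continuous fun x : ℕ → Fin d → Fin 2 => Real.ofDigits fun n => x n j :=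
    Real.continuous_ofDigits.comp (by fun_prop)
  fun_prop

lemma exists_cubePoint_eq {d : ℕ} {R : ℝ} (hR : 0 < R) {y : EuclideanSpace ℝ (Fin d)}
    (hy : ‖y‖ ≤ R) : ∃ x, cubePoint d R x = y := by
  have h : ∀ j, ∃ u : ℕ → Fin 2, Real.ofDigits u = (y j / R + 1) / 2 := by
    intro j
    have hj : |y j / R| ≤ 1 := by
      rw [abs_div, abs_of_pos hR, div_le_one hR]
      exact (PiLp.norm_apply_le y j).trans hy
    obtain ⟨u, -, hu⟩ := Real.ofDigits_SurjOn (b := 2) one_lt_two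
      (show (y j / R + 1) / 2 ∈ Set.Icc (0 : ℝ) 1 by
        obtain ⟨h1, h2⟩ := abs_le.1 hj
        constructor <;> linarith)
    exact ⟨u, hu⟩
  choose u hu using h
  refine ⟨fun n j => u j n, ?_⟩
  ext j
  simp only [cubePoint]
  rw [hu j]
  field_simp
  ring

lemma dist_cubePoint_le {d : ℕ} {R : ℝ} (hR : 0 < R) {x y : ℕ → Fin d → Fin 2} {n : ℕ}
    (h : y ∈ PiNat.cylinder x n) :
    dist (cubePoint d R y) (cubePoint d R x) ≤ (d + 1) * (2 * R) * (1 / 2 : ℝ) ^ n := by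
  rw [EuclideanSpace.dist_eq, Real.sqrt_le_iff]
  refine ⟨by positivity, ?_⟩
  have hj : ∀ j, dist (cubePoint d R y j) (cubePoint d R x j) ^ 2 ≤
      (2 * R * (1 / 2 : ℝ) ^ n) ^ 2 := by
    intro j
    have h1 := Real.abs_ofDigits_sub_ofDigits_le (x := fun n => y n j) (y := fun n => x n j)
      (n := n) fun i hi => congrFun (h i hi) j
    gcongr
    rw [Real.dist_eq]
    simp only [cubePoint]
    rw [show R * (2 * Real.ofDigits (fun n => y n j) - 1) -
      R * (2 * Real.ofDigits (fun n => x n j) - 1) = 2 * R *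
        (Real.ofDigits (fun n => y n j) - Real.ofDigits (fun n => x n j)) by ring, abs_mul,
      abs_of_pos (by positivity : 0 < 2 * R)]
    gcongr
    simpa using h1
  calc _ ≤ ∑ _j : Fin d, (2 * R * (1 / 2 : ℝ) ^ n) ^ 2 := Finset.sum_le_sum fun j _ => hj j
    _ = d * (2 * R * (1 / 2 : ℝ) ^ n) ^ 2 := by simp
    _ ≤ (d + 1) ^ 2 * (2 * R * (1 / 2 : ℝ) ^ n) ^ 2 := by
        gcongr
        nlinarith [(Nat.cast_nonneg d : (0 : ℝ) ≤ d)]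
    _ = _ := by ring

open Classical in
/-- Boundedly many cylinders of level `n` meet the preimage of a ball of radius `2 ^ (-n)`. -/
lemma exists_cylCover_preimage_ball {d : ℕ} {R : ℝ} (hR : 1 ≤ R) (z : EuclideanSpace ℝ (Fin d))
    (n : ℕ) : ∃ W : Finset ((ℕ → Fin d → Fin 2) × ℕ), (∀ p ∈ W, p.2 = n) ∧ W.card ≤ 5 ^ d ∧
      CylCover W (cubePoint d R ⁻¹' Metric.ball z ((1 / 2 : ℝ) ^ n)) := by
  set S := cubePoint d R ⁻¹' Metric.ball z ((1 / 2 : ℝ) ^ n) with hS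
  set key : (ℕ → Fin d → Fin 2) → Fin d → ℤ := fun x j => binaryPrefix (fun m => x m j) n
  set a : Fin d → ℤ := fun j => ⌊(z j / R + 1) / 2 * 2 ^ n⌋
  -- A value of `key` determines a cylinder of level `n`. In each coordinate, points coded in the
  -- ball have one of the five values around `a j`, and `Function.invFunOn` picks a representative
  -- in `S` for each attained value.
  refine ⟨(Fintype.piFinset fun j => Finset.Icc (a j - 2) (a j + 2)).image
    fun k => (Function.invFunOn key S k, n), ?_, ?_, ?_⟩
  · intro p hp
    obtain ⟨k, -, rfl⟩ := Finset.mem_image.1 hp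
    rfl
  · refine Finset.card_image_le.trans ?_
    rw [Fintype.card_piFinset]
    simp only [Int.card_Icc]
    rw [Finset.prod_congr rfl (g := fun _ => 5) fun j _ => by
      rw [show a j + 2 + 1 - (a j - 2) = 5 by ring]; rfl]
    simp
  · intro x hx
    have hR0 : 0 < R := one_pos.trans_le hR
    have hkey : key x ∈ Fintype.piFinset fun j => Finset.Icc (a j - 2) (a j + 2) := by
      rw [Fintype.mem_piFinset]
      intro j
      have h1 : |cubePoint d R x j - z j| < (1 / 2 : ℝ) ^ n := by
        have := PiLp.norm_apply_le (cubePoint d R x - z) j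
        rw [← dist_eq_norm] at this
        exact this.trans_lt hx
      simp only [cubePoint] at h1
      obtain ⟨h3, h4⟩ := binaryPrefix_le (fun m => x m j) n
      set u := Real.ofDigits fun m => x m j
      have h2 : |(u - (z j / R + 1) / 2) * 2 ^ n| < 1 := by
        have : (u - (z j / R + 1) / 2) * 2 ^ n =
            (R * (2 * u - 1) - z j) * 2 ^ n * (1 / (2 * R)) := by
          field_simp
          ring
        rw [this, abs_mul, abs_mul, abs_of_pos (by positivity : (0 : ℝ) < 2 ^ n),
          abs_of_pos (by positivity : 0 < 1 / (2 * R))]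
        have h5 : |R * (2 * u - 1) - z j| * 2 ^ n < 1 := by
          calc _ < (1 / 2 : ℝ) ^ n * 2 ^ n := by gcongr
            _ = 1 := by rw [← mul_pow]; norm_num
        have h6 : 1 / (2 * R) ≤ 1 := by
          rw [div_le_one (by positivity)]
          linarith
        calc _ ≤ |R * (2 * u - 1) - z j| * 2 ^ n * 1 := by gcongr
          _ < 1 := by rwa [mul_one]
      rw [sub_mul] at h2
      obtain ⟨h6, h7⟩ := abs_lt.1 h2
      have h8 := Int.floor_le ((z j / R + 1) / 2 * 2 ^ n)
      have h9 := Int.lt_floor_add_one ((z j / R + 1) / 2 * 2 ^ n)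
      change binaryPrefix (fun m => x m j) n ∈ Finset.Icc (a j - 2) (a j + 2)
      rw [Finset.mem_Icc]
      constructor
      · have : (a j - 3 : ℝ) < binaryPrefix (fun m => x m j) n := by
          simp only [a]
          linarith
        have : a j - 3 < binaryPrefix (fun m => x m j) n := by exact_mod_cast this
        omega
      · have : (binaryPrefix (fun m => x m j) n : ℝ) < a j + 2 := by
          simp only [a]
          linarith
        have : binaryPrefix (fun m => x m j) n < a j + 2 := by exact_mod_cast this
        omega
    refine Set.mem_biUnion (x := (Function.invFunOn key S (key x), n))
      (Finset.mem_image_of_mem _ hkey) ?_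
    have heq : key (Function.invFunOn key S (key x)) = key x := Function.invFunOn_apply_eq hx
    intro i hi
    funext j
    exact (eq_of_binaryPrefix_eq (congrFun heq j) i hi).symm

/-! ### Comparison of cylinder content with covers by balls -/

/-- The gauge `D * 2 ^ (-s * n)`. -/
def powGauge (D s : ℝ) (n : ℕ) : ℝ := D * ((1 / 2 : ℝ) ^ n) ^ s

lemma powGauge_pos {D : ℝ} (hD : 0 < D) (s : ℝ) (n : ℕ) : 0 < powGauge D s n := by
  unfold powGauge
  positivity

lemma powGauge_mono {D D' s s' : ℝ} (hD : 0 ≤ D) (hDD : D ≤ D') (hs : s' ≤ s) (n : ℕ) :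
    powGauge D s n ≤ powGauge D' s' n := by
  unfold powGauge
  refine mul_le_mul hDD (Real.rpow_le_rpow_of_exponent_ge (by positivity) ?_ hs) (by positivity)
    (hD.trans hDD)
  exact pow_le_one₀ (by norm_num) (by norm_num)

lemma tendsto_rpow_half_pow {s : ℝ} (hs : 0 < s) :
    Tendsto (fun n : ℕ => ((1 / 2 : ℝ) ^ n) ^ s) atTop (𝓝 0) := by
  have h := tendsto_pow_atTop_nhds_zero_of_lt_one (r := (1 / 2 : ℝ)) (by norm_num) (by norm_num)
  simpa [Real.zero_rpow hs.ne'] using h.rpow_const (Or.inr hs.le)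

lemma tendsto_powGauge (D : ℝ) {s : ℝ} (hs : 0 < s) : Tendsto (powGauge D s) atTop (𝓝 0) := by
  have h := (tendsto_rpow_half_pow hs).const_mul D
  rwa [mul_zero] at h

/-- The subset of `K` coded by `G`. -/
def codedSet {d : ℕ} (K : Set (EuclideanSpace ℝ (Fin d))) (R : ℝ) (G : Set (ℕ → Fin d → Fin 2)) :
    Set K := {x | (x : EuclideanSpace ℝ (Fin d)) ∈ cubePoint d R '' G}

section

variable {d : ℕ} {K : Set (EuclideanSpace ℝ (Fin d))} {R : ℝ} {G : Set (ℕ → Fin d → Fin 2)}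

lemma isClosed_codedSet (hG : IsClosed G) : IsClosed (codedSet K R G) :=
  ((hG.isCompact.image (continuous_cubePoint d R)).isClosed).preimage continuous_subtype_val

open Classical in
-- A cylinder of level `n` is mapped into a ball of radius `C * 2 ^ (-n)`. Cylinders missing `G` are
-- discarded, so that the centres can be taken in `K`.
lemma ballNull_codedSet {s : ℝ} (hs : 0 < s) (hR : 0 < R) (hG : G ⊆ cubePoint d R ⁻¹' K)
    (h : ∀ ε : ℝ, 0 < ε → ∃ W, CylCover W G ∧ cylCost (powGauge 1 s) W < ε) :
    BallNull s (codedSet K R G) := by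
  intro ε hε
  set C : ℝ := (d + 1) * (2 * R) + 1 with hC
  have hC0 : 0 < C := by positivity
  -- The first bound controls the sum; the second controls each radius, since a single term is at
  -- most the total cost.
  obtain ⟨W, hW, hc⟩ := h (min (ε / C ^ s) ((ε / C) ^ s)) (by positivity)
  have hex : ∀ p : (ℕ → Fin d → Fin 2) × ℕ, (PiNat.cylinder p.1 p.2 ∩ G).Nonempty →
      ∃ z : K, ∃ y ∈ PiNat.cylinder p.1 p.2, cubePoint d R y = z := by
    rintro p ⟨y, hy, hyG⟩
    exact ⟨⟨_, hG hyG⟩, y, hy, rfl⟩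
  have hterm : ∀ p ∈ W, ((1 / 2 : ℝ) ^ p.2) ^ s ≤ cylCost (powGauge 1 s) W := fun p hp => by
    have := Finset.single_le_sum (f := fun p : (ℕ → Fin d → Fin 2) × ℕ => powGauge 1 s p.2)
      (fun p _ => (powGauge_pos one_pos s p.2).le) hp
    simpa [powGauge, cylCost] using this
  set V := W.filter fun p : (ℕ → Fin d → Fin 2) × ℕ => (PiNat.cylinder p.1 p.2 ∩ G).Nonempty
  by_cases hV : V.Nonempty
  swap
  · refine ⟨∅, by simp, ?_, by simpa using hε⟩
    rintro x ⟨w, hw, hwx⟩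
    obtain ⟨p, hp, hwp⟩ := Set.mem_iUnion₂.1 (hW hw)
    exact absurd ⟨p, Finset.mem_filter.2 ⟨hp, w, hwp, hw⟩⟩ hV
  obtain ⟨p₀, hp₀⟩ := hV
  have : Nonempty K := ⟨(hex p₀ (Finset.mem_filter.1 hp₀).2).choose⟩
  choose! z y hy hyz using hex
  refine ⟨V.image fun p => (z p, C * (1 / 2 : ℝ) ^ p.2), ?_, ?_, ?_⟩
  · intro q hq
    obtain ⟨p, hp, rfl⟩ := Finset.mem_image.1 hq
    refine ⟨by positivity, ?_⟩
    have h1 := (hterm p (Finset.mem_filter.1 hp).1).trans_lt (hc.trans_le (min_le_right _ _))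
    rw [Real.rpow_lt_rpow_iff (by positivity) (by positivity) hs, lt_div_iff₀ hC0] at h1
    linarith
  · rintro x ⟨w, hw, hwx⟩
    obtain ⟨p, hp, hwp⟩ := Set.mem_iUnion₂.1 (hW hw)
    have hne : (PiNat.cylinder p.1 p.2 ∩ G).Nonempty := ⟨w, hwp, hw⟩
    refine Set.mem_biUnion (x := (z p, C * (1 / 2 : ℝ) ^ p.2))
      (Finset.mem_coe.2 (Finset.mem_image_of_mem _ (Finset.mem_filter.2 ⟨hp, hne⟩))) ?_
    rw [Metric.mem_ball, Subtype.dist_eq, ← hwx, ← hyz p hne]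
    have h2 : w ∈ PiNat.cylinder (y p) p.2 := by
      rw [PiNat.mem_cylinder_iff_eq.1 (hy p hne)]
      exact hwp
    refine (dist_cubePoint_le hR h2).trans_lt ?_
    have : (0 : ℝ) < (1 / 2 : ℝ) ^ p.2 := by positivity
    exact mul_lt_mul_of_pos_right (by rw [hC]; linarith) this
  · refine (Finset.sum_image_le_of_nonneg (g := fun p => (z p, C * (1 / 2 : ℝ) ^ p.2))
      (f := fun q : K × ℝ => q.2 ^ s) fun q hq => ?_).trans_lt ?_
    · obtain ⟨p, -, rfl⟩ := Finset.mem_image.1 hq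
      positivity
    · calc ∑ p ∈ V, (C * (1 / 2 : ℝ) ^ p.2) ^ s ≤ ∑ p ∈ W, (C * (1 / 2 : ℝ) ^ p.2) ^ s :=
            Finset.sum_le_sum_of_subset_of_nonneg (Finset.filter_subset _ _)
              fun p _ _ => by positivity
        _ = C ^ s * cylCost (powGauge 1 s) W := by
            rw [cylCost, Finset.mul_sum]
            refine Finset.sum_congr rfl fun p _ => ?_
            rw [Real.mul_rpow hC0.le (by positivity), powGauge, one_mul]
        _ < C ^ s * (ε / C ^ s) := by
            gcongr
            exact hc.trans_le (min_le_left _ _)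
        _ = ε := by
            field_simp

open Classical in
-- A ball of radius `r` lies in one of radius `2 ^ (-n) ≤ 2 r`, whose preimage is covered by `5 ^ d`
-- cylinders of level `n`. A ball cover thus becomes a cylinder cover at the cost of the factor `5 ^
-- d * (D * 2 ^ s)`.
lemma not_isBig_of_ballNull {s D : ℝ} (hs : 0 < s) (hD : 0 < D) (hR : 1 ≤ R)
    (hG : G ⊆ cubePoint d R ⁻¹' K) (h : BallNull s (codedSet K R G)) :
    ¬ IsBig (powGauge D s) G := by
  intro hbig
  obtain ⟨W, hW, hcov, hsum⟩ := h (min 1 (1 / (5 ^ d * (D * 2 ^ s)))) (by positivity)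
  have hex : ∀ p : K × ℝ, 0 < p.2 → p.2 ≤ 1 → ∃ n : ℕ, p.2 ≤ (1 / 2 : ℝ) ^ n ∧
      (1 / 2 : ℝ) ^ n ≤ 2 * p.2 := by
    intro p hp hp1
    obtain ⟨n, h1, h2⟩ := exists_nat_pow_near_of_lt_one hp hp1 (y := (1 / 2 : ℝ)) (by norm_num)
      (by norm_num)
    refine ⟨n, h2, ?_⟩
    rw [pow_succ] at h1
    linarith
  choose! n hn1 hn2 using hex
  choose V hV hcard hVc using fun p : K × ℝ =>
    exists_cylCover_preimage_ball hR (p.1 : EuclideanSpace ℝ (Fin d)) (n p)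
  have hW1 : ∀ p ∈ W, 0 < p.2 ∧ p.2 ≤ 1 := fun p hp =>
    ⟨(hW p hp).1, ((hW p hp).2.trans_le (min_le_left _ _)).le⟩
  have h1 := hbig (W.biUnion V) (by
    intro x hx
    have hx' : (⟨_, hG hx⟩ : K) ∈ codedSet K R G := ⟨x, hx, rfl⟩
    obtain ⟨p, hp, hxp⟩ := Set.mem_iUnion₂.1 (hcov hx')
    have : x ∈ cubePoint d R ⁻¹' Metric.ball (p.1 : EuclideanSpace ℝ (Fin d))
        ((1 / 2 : ℝ) ^ (n p)) := by
      rw [Metric.mem_ball, Subtype.dist_eq] at hxp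
      exact hxp.trans_le (hn1 p (hW1 p hp).1 (hW1 p hp).2)
    obtain ⟨q, hq, hxq⟩ := Set.mem_iUnion₂.1 (hVc p this)
    exact Set.mem_biUnion (x := q) (Finset.mem_biUnion.2 ⟨p, hp, hq⟩) hxq)
  have h2 := cylCost_biUnion_le (fun n => (powGauge_pos hD s n).le) W V
  have h3 : ∀ p ∈ W, cylCost (powGauge D s) (V p) ≤ 5 ^ d * (D * 2 ^ s) * p.2 ^ s := by
    intro p hp
    obtain ⟨hp0, hp1⟩ := hW1 p hp
    calc cylCost (powGauge D s) (V p) = ∑ q ∈ V p, powGauge D s (n p) :=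
          Finset.sum_congr rfl fun q hq => by rw [hV p q hq]
      _ = (V p).card * powGauge D s (n p) := by rw [Finset.sum_const, nsmul_eq_mul]
      _ ≤ 5 ^ d * (D * (2 * p.2) ^ s) := by
          unfold powGauge
          gcongr
          · exact_mod_cast hcard p
          · exact hn2 p hp0 hp1
      _ = _ := by
          rw [Real.mul_rpow (by norm_num) hp0.le]
          ring
  have h4 := Finset.sum_le_sum h3
  rw [← Finset.mul_sum] at h4
  have h5 := hsum.trans_le (min_le_right _ _)
  rw [lt_div_iff₀ (by positivity)] at h5
  linarith

/-- A minimal set for the gauge of exponent `c` is null in all larger dimensions. -/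
lemma IsMinimalBig.ballNull_codedSet {c b D : ℝ} (hc : 0 < c) (hcb : c < b) (hD : 0 < D)
    (hR : 0 < R) (hG : G ⊆ cubePoint d R ⁻¹' K) (h : IsMinimalBig (powGauge D c) G) :
    BallNull b (codedSet K R G) := by
  refine Multifractal.ballNull_codedSet (hc.trans hcb) hR hG fun ε hε => ?_
  -- On cylinders of level at least `N`, passing from exponent `c` to `b` gains the factor `2 ^ (-N
  -- (b - c))`, while the cost for `c` stays below 2.
  have h0 := tendsto_rpow_half_pow (sub_pos.2 hcb)
  obtain ⟨N, hN⟩ := (h0.eventually (gt_mem_nhds (by positivity : 0 < ε * D / 2))).exists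
  obtain ⟨W, hW, hl, hcost⟩ := h.exists_fine_cover (powGauge_pos hD c) (tendsto_powGauge D hc) N
    one_pos
  refine ⟨W, hW, ?_⟩
  have hterm : ∀ p ∈ W, powGauge 1 b p.2 ≤
      ((1 / 2 : ℝ) ^ N) ^ (b - c) / D * powGauge D c p.2 := by
    intro p hp
    have h1 : ((1 / 2 : ℝ) ^ p.2) ^ (b - c) ≤ ((1 / 2 : ℝ) ^ N) ^ (b - c) :=
      Real.rpow_le_rpow (by positivity)
        (pow_le_pow_of_le_one (by norm_num) (by norm_num) (hl p hp)) (sub_pos.2 hcb).le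
    calc powGauge 1 b p.2 = ((1 / 2 : ℝ) ^ p.2) ^ (b - c) * ((1 / 2 : ℝ) ^ p.2) ^ c := by
          rw [powGauge, one_mul, ← Real.rpow_add (by positivity), sub_add_cancel]
      _ ≤ ((1 / 2 : ℝ) ^ N) ^ (b - c) * ((1 / 2 : ℝ) ^ p.2) ^ c := by gcongr
      _ = _ := by
          rw [powGauge]
          field_simp
  have h2 := Finset.sum_le_sum hterm
  rw [← Finset.mul_sum] at h2
  change cylCost (powGauge 1 b) W ≤ _ * cylCost (powGauge D c) W at h2
  calc cylCost (powGauge 1 b) W ≤ ((1 / 2 : ℝ) ^ N) ^ (b - c) / D * cylCost (powGauge D c) W := h2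
    _ ≤ ((1 / 2 : ℝ) ^ N) ^ (b - c) / D * 2 := by
        gcongr
        linarith
    _ < ε * D / 2 / D * 2 := by gcongr
    _ = ε := by field_simp

end

/-! ### The countable family of closed sets -/

open Classical in
/-- A minimal subset of content at least one, if `E` has content at least one. -/
def minimalBigSubset {A : Type*} [TopologicalSpace A] (g : ℕ → ℝ) (E : Set (ℕ → A)) :
    Set (ℕ → A) :=
  if h : ∃ E' ⊆ E, IsMinimalBig g E' then h.choose else E

/-- Iterated minimal subsets for the gauges with a given list of exponents, the last exponent of
the list being used first. -/
def iteratedMinimal {A : Type*} [TopologicalSpace A] (E : Set (ℕ → A)) (D : ℝ) :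
    List ℚ → Set (ℕ → A)
  | [] => E
  | q :: l => minimalBigSubset (powGauge D q) (iteratedMinimal E D l)

lemma minimalBigSubset_subset {A : Type*} [TopologicalSpace A] (g : ℕ → ℝ) (E : Set (ℕ → A)) :
    minimalBigSubset g E ⊆ E := by
  unfold minimalBigSubset
  split_ifs with h
  · exact h.choose_spec.1
  · exact subset_rfl

lemma isMinimalBig_minimalBigSubset {A : Type*} [TopologicalSpace A] [DiscreteTopology A]
    [Finite A] {g : ℕ → ℝ} {E : Set (ℕ → A)} (hE : IsClosed E) (hbig : IsBig g E) :
    IsMinimalBig g (minimalBigSubset g E) := by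
  have h := exists_isMinimalBig hE hbig
  rw [minimalBigSubset, dif_pos h]
  exact h.choose_spec.2

lemma iteratedMinimal_subset {A : Type*} [TopologicalSpace A] (E : Set (ℕ → A)) (D : ℝ)
    (l : List ℚ) : iteratedMinimal E D l ⊆ E := by
  induction l with
  | nil => exact subset_rfl
  | cons q l ih => exact (minimalBigSubset_subset _ _).trans ih

/-- A compact subset of a Euclidean space has a countable family of closed subsets of controlled
dimension, such that for each `α` some set of positive `α`-dimensional measure lies in members of
the family of dimension arbitrarily close to `α`. -/
theorem exists_countable_family {d : ℕ} {K : Set (EuclideanSpace ℝ (Fin d))} (hK : IsCompact K) :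
    ∃ (ι : Type) (_ : Countable ι) (F : ι → Set K) (b : ι → ℝ),
      (∀ i, IsClosed (F i) ∧ 0 < b i ∧ BallNull (b i) (F i)) ∧
      ∀ α : ℝ, 0 < α → ENNReal.ofReal α < dimH (Set.univ : Set K) →
        ∃ E : Set K, μH[α] E ≠ 0 ∧ ∀ β, α < β → ∃ i, b i < β ∧ E ⊆ F i := by
  have : CompactSpace K := isCompact_iff_compactSpace.1 hK
  obtain ⟨R, hR1, hR⟩ : ∃ R : ℝ, 1 ≤ R ∧ ∀ y ∈ K, ‖y‖ ≤ R := by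
    obtain ⟨R, hR⟩ := hK.isBounded.exists_norm_le
    exact ⟨max R 1, le_max_right _ _, fun y hy => (hR y hy).trans (le_max_left _ _)⟩
  have hR0 : 0 < R := one_pos.trans_le hR1
  set Khat := cubePoint d R ⁻¹' K with hKhat
  have hKc : IsClosed Khat := hK.isClosed.preimage (continuous_cubePoint d R)
  have huniv : codedSet K R Khat = Set.univ := by
    refine Set.eq_univ_of_forall fun x => ?_
    obtain ⟨y, hy⟩ := exists_cubePoint_eq hR0 (hR x x.2)
    exact ⟨y, by simp [hKhat, hy], hy⟩
  -- The choice of minimal subset depends only on the gauge and the ambient set, so triples made of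
  -- `D`, a finite list of rational exponents and a rational `b` are enough indices.
  refine ⟨{p : ℕ × List ℚ × ℚ // IsClosed (codedSet K R (iteratedMinimal Khat p.1 p.2.1)) ∧
      0 < (p.2.2 : ℝ) ∧ BallNull (p.2.2 : ℝ) (codedSet K R (iteratedMinimal Khat p.1 p.2.1))},
    inferInstance, fun p => codedSet K R (iteratedMinimal Khat p.1.1 p.1.2.1),
    fun p => p.1.2.2, fun p => p.2, fun α hα hαd => ?_⟩
  obtain ⟨s, hαs, hsd⟩ := exists_real_btwn hαd
  have hs0 : 0 < s := hα.trans hαs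
  -- If no integer `D` worked, there would be covers of cost below `1 / D` for the gauge with
  -- constant 1, making `K` null in dimension `s`.
  obtain ⟨D, hD, hbig⟩ : ∃ D : ℕ, 0 < (D : ℝ) ∧ IsBig (powGauge D s) Khat := by
    by_contra! hcon
    have hnull : BallNull s (codedSet K R Khat) := by
      refine ballNull_codedSet hs0 hR0 subset_rfl fun ε hε => ?_
      obtain ⟨D, hD⟩ := exists_nat_gt (1 / ε)
      have hD0 : (0 : ℝ) < D := (by positivity : 0 < 1 / ε).trans hD
      have h1 := hcon D hD0
      unfold IsBig at h1
      push Not at h1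
      obtain ⟨W, hW, hc⟩ := h1
      refine ⟨W, hW, ?_⟩
      have h2 : cylCost (powGauge D s) W = D * cylCost (powGauge 1 s) W := by
        simp only [cylCost, powGauge, one_mul, Finset.mul_sum]
      rw [h2] at hc
      rw [div_lt_iff₀ hε] at hD
      by_contra! hle
      nlinarith
    rw [huniv] at hnull
    exact not_ballNull_of_lt_dimH hs0 hsd hnull
  obtain ⟨q', hq'anti, hq'α, hq'lim⟩ := Real.exists_seq_rat_strictAnti_tendsto α
  obtain ⟨k₀, hk₀⟩ := (hq'lim.eventually (gt_mem_nhds hαs)).exists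
  -- The shift starts the sequence below `s`, so that the content of the whole coding set is at
  -- least one for the first exponent.
  set q : ℕ → ℚ := fun k => q' (k + k₀) with hq
  have hqα : ∀ k, α < q k := fun k => hq'α _
  have hqlim : Tendsto (fun k => (q k : ℝ)) atTop (𝓝 α) := (tendsto_add_atTop_iff_nat k₀).2 hq'lim
  have hqs : (q 0 : ℝ) ≤ s := by simpa [hq] using hk₀.le
  have hqanti : ∀ k, (q (k + 1) : ℝ) ≤ q k := fun k => by
    exact_mod_cast hq'anti.antitone (by omega)
  let l : ℕ → List ℚ := fun k => Nat.rec [] (fun k l => q k :: l) k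
  set G : ℕ → Set (ℕ → Fin d → Fin 2) := fun k => iteratedMinimal Khat D (l k) with hGdef
  have hGsucc : ∀ k, G (k + 1) = minimalBigSubset (powGauge D (q k)) (G k) := fun k => rfl
  have hG : ∀ k, IsClosed (G k) ∧ IsBig (powGauge D (q k)) (G k) := by
    intro k
    induction k with
    | zero => exact ⟨hKc, hbig.mono_gauge (powGauge_mono hD.le le_rfl hqs)⟩
    | succ k ih =>
      have h := isMinimalBig_minimalBigSubset ih.1 ih.2
      rw [hGsucc]
      exact ⟨h.isClosed, h.isBig.mono_gauge (powGauge_mono hD.le le_rfl (hqanti k))⟩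
  have hGmin : ∀ k, IsMinimalBig (powGauge D (q k)) (G (k + 1)) := fun k =>
    isMinimalBig_minimalBigSubset (hG k).1 (hG k).2
  have hGanti : Antitone G := antitone_nat_of_succ_le fun k => minimalBigSubset_subset _ _
  have hGK : ∀ k, G k ⊆ Khat := fun k => iteratedMinimal_subset _ _ _
  -- Lowering the exponent to `α` only increases the gauge, so every `G k` is big for the one gauge
  -- of exponent `α`.
  have hInter : IsBig (powGauge D α) (⋂ k, G k) :=
    isBig_iInter hGanti.directed_ge (fun k => (hG k).1) fun k =>
      (hG k).2.mono_gauge (powGauge_mono hD.le le_rfl (hqα k).le)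
  refine ⟨codedSet K R (⋂ k, G k), fun h0 => ?_, fun β hβ => ?_⟩
  · have hcl : IsClosed (codedSet K R (⋂ k, G k)) := isClosed_codedSet (isClosed_iInter fun k => (hG k).1)
    exact not_isBig_of_ballNull hα hD hR1 ((Set.iInter_subset G 0).trans (hGK 0))
      (ballNull_of_hausdorffMeasure_eq_zero hcl.isCompact hα h0) hInter
  · obtain ⟨k, hk⟩ := (hqlim.eventually (gt_mem_nhds hβ)).exists
    obtain ⟨b, hb1, hb2⟩ := exists_rat_btwn hk
    refine ⟨⟨(D, l (k + 1), b), isClosed_codedSet (hG (k + 1)).1, hα.trans ((hqα k).trans hb1), ?_⟩,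
      hb2, ?_⟩
    · exact (hGmin k).ballNull_codedSet (hα.trans (hqα k)) hb1 hD hR0 (hGK (k + 1))
    · rintro x ⟨y, hy, hyx⟩
      exact ⟨y, Set.mem_iInter.1 hy (k + 1), hyx⟩

/-! ### Mixtures, the weak topology and Baire category -/

section Combinations

variable {X : Type*} [MeasurableSpace X]

/-- The convex combination `(1 - t) ν + t σ`. -/
def mixture (t : Set.Icc (0 : ℝ) 1) (ν σ : ProbabilityMeasure X) : ProbabilityMeasure X :=
  ⟨ENNReal.ofReal (1 - t) • (ν : Measure X) + ENNReal.ofReal t • (σ : Measure X), ⟨by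
    simp only [Measure.coe_add, Measure.coe_smul, Pi.add_apply, Pi.smul_apply, measure_univ,
      smul_eq_mul, mul_one]
    rw [← ENNReal.ofReal_add (sub_nonneg.2 t.2.2) t.2.1]
    simp⟩⟩

lemma mixture_apply (t : Set.Icc (0 : ℝ) 1) (ν σ : ProbabilityMeasure X) (s : Set X) :
    (mixture t ν σ : Measure X) s =
      ENNReal.ofReal (1 - t) * (ν : Measure X) s + ENNReal.ofReal t * (σ : Measure X) s := rfl

/-- The probability measure `∑ w p δ_(z p)`. -/
def discreteProb {ι : Type*} (W : Finset ι) (z : ι → X) (w : ι → ℝ) (hw : ∀ p ∈ W, 0 ≤ w p)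
    (hsum : ∑ p ∈ W, w p = 1) : ProbabilityMeasure X :=
  ⟨∑ p ∈ W, ENNReal.ofReal (w p) • Measure.dirac (z p), ⟨by
    simp only [Measure.coe_finsetSum, Finset.sum_apply, Measure.coe_smul, Pi.smul_apply,
      measure_univ, smul_eq_mul, mul_one]
    rw [← ENNReal.ofReal_sum_of_nonneg hw, hsum, ENNReal.ofReal_one]⟩⟩

lemma discreteProb_apply {ι : Type*} (W : Finset ι) (z : ι → X) (w : ι → ℝ)
    (hw : ∀ p ∈ W, 0 ≤ w p) (hsum : ∑ p ∈ W, w p = 1) (s : Set X) (hs : MeasurableSet s) :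
    (discreteProb W z w hw hsum : Measure X) s =
      ∑ p ∈ W, ENNReal.ofReal (w p) * s.indicator 1 (z p) := by
  change (∑ p ∈ W, ENNReal.ofReal (w p) • Measure.dirac (z p)) s = _
  simp only [Measure.coe_finsetSum, Finset.sum_apply, Measure.coe_smul, Pi.smul_apply,
    smul_eq_mul, Measure.dirac_apply' _ hs]

lemma le_discreteProb_apply {ι : Type*} (W : Finset ι) (z : ι → X) (w : ι → ℝ)
    (hw : ∀ p ∈ W, 0 ≤ w p) (hsum : ∑ p ∈ W, w p = 1) (s : Set X) (hs : MeasurableSet s)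
    (V : Finset ι) (hV : V ⊆ W) (hVs : ∀ p ∈ V, z p ∈ s) :
    ENNReal.ofReal (∑ p ∈ V, w p) ≤ (discreteProb W z w hw hsum : Measure X) s := by
  rw [discreteProb_apply _ _ _ _ _ _ hs, ENNReal.ofReal_sum_of_nonneg fun p hp => hw p (hV hp)]
  calc _ = ∑ p ∈ V, ENNReal.ofReal (w p) * s.indicator 1 (z p) :=
        Finset.sum_congr rfl fun p hp => by simp [hVs p hp]
    _ ≤ _ := Finset.sum_le_sum_of_subset hV

end Combinations

section Weak

variable {X : Type*} [MetricSpace X] [MeasurableSpace X] [BorelSpace X]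

lemma isOpen_setOf_lt_measure {U : Set X} (hU : IsOpen U) (c : ℝ≥0∞) :
    IsOpen {μ : ProbabilityMeasure X | c < (μ : Measure X) U} := by
  rw [isOpen_iff_mem_nhds]
  intro μ hμ
  exact eventually_lt_of_lt_liminf (lt_of_lt_of_le hμ
    (ProbabilityMeasure.le_liminf_measure_open_of_tendsto tendsto_id hU))

lemma isOpen_setOf_measure_lt {F : Set X} (hF : IsClosed F) (c : ℝ≥0∞) :
    IsOpen {μ : ProbabilityMeasure X | (μ : Measure X) F < c} := by
  rw [isOpen_iff_mem_nhds]
  intro μ hμ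
  exact eventually_lt_of_limsup_lt (lt_of_le_of_lt
    (ProbabilityMeasure.limsup_measure_closed_le_of_tendsto tendsto_id hF) hμ)

/-- Mixtures with a small weight on the second measure are close to the first one, uniformly in
the second one. -/
lemma tendsto_mixture {t : ℕ → Set.Icc (0 : ℝ) 1} (ht : Tendsto (fun n => (t n : ℝ)) atTop (𝓝 0))
    (ν : ProbabilityMeasure X) (σ : ℕ → ProbabilityMeasure X) :
    Tendsto (fun n => mixture (t n) ν (σ n)) atTop (𝓝 ν) := by
  rw [ProbabilityMeasure.tendsto_iff_forall_integral_tendsto]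
  intro f
  have hint : ∀ (ρ : ProbabilityMeasure X), Integrable f (ρ : Measure X) := fun ρ => f.integrable _
  have heq : ∀ n, ∫ x, f x ∂(mixture (t n) ν (σ n) : Measure X) =
      (1 - t n) * ∫ x, f x ∂(ν : Measure X) + t n * ∫ x, f x ∂(σ n : Measure X) := by
    intro n
    change ∫ x, f x ∂(ENNReal.ofReal (1 - t n) • (ν : Measure X) +
      ENNReal.ofReal (t n) • (σ n : Measure X)) = _
    rw [integral_add_measure ((hint ν).smul_measure (by simp)) ((hint (σ n)).smul_measure (by simp)),
      integral_smul_measure, integral_smul_measure, ENNReal.toReal_ofReal (sub_nonneg.2 (t n).2.2),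
      ENNReal.toReal_ofReal (t n).2.1]
    rfl
  simp only [heq]
  have h1 : Tendsto (fun n => (1 - (t n : ℝ)) * ∫ x, f x ∂(ν : Measure X)) atTop
      (𝓝 ((1 - 0) * ∫ x, f x ∂(ν : Measure X))) := (ht.const_sub 1).mul_const _
  have h2 : Tendsto (fun n => (t n : ℝ) * ∫ x, f x ∂(σ n : Measure X)) atTop (𝓝 0) := by
    refine squeeze_zero_norm (a := fun n => (t n : ℝ) * ‖f‖) (fun n => ?_) (by
      simpa using ht.mul_const ‖f‖)
    rw [norm_mul, Real.norm_of_nonneg (t n).2.1]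
    gcongr
    · exact (t n).2.1
    · simpa using f.norm_integral_le_norm (σ n : Measure X)
  simpa using h1.add h2

/-- The added measure may depend on its weight `t`: convergence of the mixtures to `ν` is uniform in
it. -/
lemma dense_of_mixture {O : Set (ProbabilityMeasure X)}
    (h : ∀ ν, ∀ t : Set.Icc (0 : ℝ) 1, 0 < (t : ℝ) → ∃ σ, mixture t ν σ ∈ O) : Dense O := by
  intro ν
  have hpos : ∀ n : ℕ, 0 < 1 / ((n : ℝ) + 1) := fun n => by positivity
  have hle : ∀ n : ℕ, 1 / ((n : ℝ) + 1) ≤ 1 := fun n => by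
    rw [div_le_one (by positivity)]
    linarith [(Nat.cast_nonneg n : (0 : ℝ) ≤ n)]
  choose σ hσ using fun n : ℕ => h ν ⟨1 / ((n : ℝ) + 1), (hpos n).le, hle n⟩ (hpos n)
  exact mem_closure_of_tendsto (tendsto_mixture tendsto_one_div_add_atTop_nhds_zero_nat ν σ)
    (Eventually.of_forall hσ)

lemma typical_of_forall_mem [CompactSpace X] {ι : Type*} [Countable ι]
    {O : ι → Set (ProbabilityMeasure X)} (ho : ∀ i, IsOpen (O i)) (hd : ∀ i, Dense (O i))
    {p : ProbabilityMeasure X → Prop} (h : ∀ μ, (∀ i, μ ∈ O i) → p μ) : Typical p :=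
  ⟨⋂ i, O i, .iInter_of_isOpen ho, dense_iInter_of_isOpen ho hd, fun μ hμ => h μ (Set.mem_iInter.1 hμ)⟩

end Weak

/-! ### Typical measures have small local dimension on null sets -/

section LocalDim

variable {X : Type*} [MetricSpace X] [MeasurableSpace X] [BorelSpace X]

/-- The measures for which `F` is covered, at scale `δ`, by balls of large measure. -/
def heavyCover (F : Set X) (b δ : ℝ) : Set (ProbabilityMeasure X) :=
  {μ | ∃ W : Finset (X × ℝ), (∀ p ∈ W, 0 < p.2 ∧ p.2 < δ) ∧ F ⊆ (⋃ p ∈ W, Metric.ball p.1 p.2) ∧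
    ∀ p ∈ W, ENNReal.ofReal ((2 * p.2) ^ b) < (μ : Measure X) (Metric.ball p.1 p.2)}

lemma isOpen_heavyCover (F : Set X) (b δ : ℝ) : IsOpen (heavyCover F b δ) := by
  have : heavyCover F b δ = ⋃ W ∈ {W : Finset (X × ℝ) | (∀ p ∈ W, 0 < p.2 ∧ p.2 < δ) ∧
      F ⊆ (⋃ p ∈ W, Metric.ball p.1 p.2)}, ⋂ p ∈ W, {μ : ProbabilityMeasure X |
        ENNReal.ofReal ((2 * p.2) ^ b) < (μ : Measure X) (Metric.ball p.1 p.2)} := by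
    ext μ
    simp [heavyCover, and_assoc]
  rw [this]
  exact isOpen_biUnion fun W _ => isOpen_biInter_finset fun p _ =>
    isOpen_setOf_lt_measure Metric.isOpen_ball _

/-- The added measure has at each centre a mass proportional to the `b`-th power of the radius. As
the sum `S` of these powers is below `t / 2 ^ b`, the weight `t * (ρ ^ b / S)` exceeds `(2 ρ) ^ b`.
-/
lemma dense_heavyCover {F : Set X} {b δ : ℝ} (hF : BallNull b F) (hδ : 0 < δ) :
    Dense (heavyCover F b δ) := by
  refine dense_of_mixture fun ν t ht => ?_
  obtain ⟨W, hW, hcov, hsum⟩ := hF (min δ (t / 2 ^ b)) (by positivity)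
  have hWδ : ∀ p ∈ W, 0 < p.2 ∧ p.2 < δ := fun p hp =>
    ⟨(hW p hp).1, (hW p hp).2.trans_le (min_le_left _ _)⟩
  rcases W.eq_empty_or_nonempty with rfl | hne
  · exact ⟨ν, ∅, by simp, hcov, by simp⟩
  set S := ∑ p ∈ W, p.2 ^ b with hS
  have hpos : ∀ p ∈ W, 0 < p.2 ^ b := fun p hp => Real.rpow_pos_of_pos (hW p hp).1 b
  have hS0 : 0 < S := Finset.sum_pos hpos hne
  have hw : ∀ p ∈ W, 0 ≤ p.2 ^ b / S := fun p hp => (div_pos (hpos p hp) hS0).le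
  have hsum1 : ∑ p ∈ W, p.2 ^ b / S = 1 := by rw [← Finset.sum_div, div_self hS0.ne']
  refine ⟨discreteProb W Prod.fst (fun p => p.2 ^ b / S) hw hsum1, W, hWδ, hcov, fun p hp => ?_⟩
  have h1 := le_discreteProb_apply W Prod.fst (fun p => p.2 ^ b / S) hw hsum1
    (Metric.ball p.1 p.2) Metric.isOpen_ball.measurableSet {p} (by simpa using hp)
    (by simpa using (hW p hp).1)
  rw [Finset.sum_singleton] at h1
  calc ENNReal.ofReal ((2 * p.2) ^ b) < ENNReal.ofReal (t * (p.2 ^ b / S)) := by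
        have h2 := hpos p hp
        rw [ENNReal.ofReal_lt_ofReal_iff (by positivity),
          Real.mul_rpow (by norm_num) (hW p hp).1.le]
        have h3 := hsum.trans_le (min_le_right _ _)
        rw [lt_div_iff₀ (by positivity)] at h3
        rw [mul_div_assoc', lt_div_iff₀ hS0]
        nlinarith
    _ = ENNReal.ofReal t * ENNReal.ofReal (p.2 ^ b / S) := ENNReal.ofReal_mul t.2.1
    _ ≤ _ := by
        rw [mixture_apply]
        exact le_add_left (by gcongr)

end LocalDim

lemma lowerLocalDim_le_of_forall_mem_heavyCover {X : Type*}
    [MetricSpace X] [MeasurableSpace X] {F : Set X} {b : ℝ} {μ : ProbabilityMeasure X}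
    (h : ∀ n : ℕ, μ ∈ heavyCover F b (1 / ((n : ℝ) + 1))) {x : X} (hx : x ∈ F) :
    lowerLocalDim (μ : Measure X) x ≤ (b : EReal) := by
  refine liminf_log_div_log_le (g := fun r => (μ : Measure X) (Metric.ball x r))
    (frequently_nhdsGT_zero fun ε hε => ?_)
  obtain ⟨n, hn⟩ := exists_nat_one_div_lt (half_pos hε)
  obtain ⟨W, hW, hcov, hμ⟩ := h n
  obtain ⟨p, hp, hxp⟩ := Set.mem_iUnion₂.1 (hcov hx)
  obtain ⟨hp0, hpn⟩ := hW p hp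
  -- Doubling the radius makes the ball centred at `x` contain the heavy ball; this is why
  -- `heavyCover` is stated with `(2 * p.2) ^ b`.
  refine ⟨2 * p.2, by positivity, by linarith, (hμ p hp).le.trans (measure_mono ?_)⟩
  refine Metric.ball_subset_ball' ?_
  rw [Metric.mem_ball, dist_comm] at hxp
  linarith

/-! ### Typical measures are spread out at some scales -/

section Spectrum

variable {X : Type*} [MetricSpace X] [MeasurableSpace X] [BorelSpace X]

/-- The measures giving, at some scale smaller than `δ`, a non-negligible mass to balls of small
mass. -/
def spreadOut (X : Type*) [MetricSpace X] [MeasurableSpace X] (a η δ : ℝ) :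
    Set (ProbabilityMeasure X) :=
  {μ | ∃ r : ℝ, (0 < r ∧ r < δ) ∧ ∃ T : Finset X,
    (∀ x ∈ T, (μ : Measure X) (Metric.closedBall x (2 * r)) < ENNReal.ofReal (r ^ a)) ∧
    ENNReal.ofReal (r ^ η) < (μ : Measure X) (⋃ x ∈ T, Metric.ball x r)}

lemma isOpen_spreadOut (a η δ : ℝ) : IsOpen (spreadOut X a η δ) := by
  have : spreadOut X a η δ = ⋃ r ∈ {r : ℝ | 0 < r ∧ r < δ}, ⋃ T : Finset X,
      (⋂ x ∈ T, {μ : ProbabilityMeasure X |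
        (μ : Measure X) (Metric.closedBall x (2 * r)) < ENNReal.ofReal (r ^ a)}) ∩
      {μ : ProbabilityMeasure X |
        ENNReal.ofReal (r ^ η) < (μ : Measure X) (⋃ x ∈ T, Metric.ball x r)} := by
    ext μ
    simp [spreadOut]
  rw [this]
  exact isOpen_biUnion fun r _ => isOpen_iUnion fun T =>
    (isOpen_biInter_finset fun x _ => isOpen_setOf_measure_lt Metric.isClosed_closedBall _).inter
      (isOpen_setOf_lt_measure (isOpen_biUnion fun x _ => Metric.isOpen_ball) _)

lemma exists_finset_separated_cover (X : Type*) [MetricSpace X] [CompactSpace X] {ρ : ℝ}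
    (hρ : 0 < ρ) : ∃ T : Finset X, (∀ x ∈ T, ∀ y ∈ T, x ≠ y → ρ < dist x y) ∧
      ∀ x, ∃ y ∈ T, dist x y ≤ ρ := by
  lift ρ to ℝ≥0 using hρ.le
  have hfin : Metric.packingNumber ρ (Set.univ : Set X) ≠ ⊤ := by
    obtain ⟨N, -, hN, hcov⟩ := Metric.exists_finite_isCover_of_isCompact (ε := ρ / 2)
      (by simpa using (NNReal.coe_pos.1 hρ).ne') (isCompact_univ (X := X))
    have h1 := Metric.packingNumber_two_mul_le_externalCoveringNumber (ρ / 2) (Set.univ : Set X)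
    rw [mul_div_cancel₀ ρ two_ne_zero] at h1
    exact ((h1.trans hcov.externalCoveringNumber_le_encard).trans_lt hN.encard_lt_top).ne
  have hTfin : (Metric.maximalSeparatedSet ρ (Set.univ : Set X)).Finite := by
    rw [← Set.encard_ne_top_iff, Metric.encard_maximalSeparatedSet hfin]
    exact hfin
  refine ⟨hTfin.toFinset, fun x hx y hy hxy => ?_, fun x => ?_⟩
  · have h := Metric.isSeparated_maximalSeparatedSet (hTfin.mem_toFinset.1 hx)
      (hTfin.mem_toFinset.1 hy) hxy
    change (ρ : ℝ≥0∞) < edist x y at h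
    rw [edist_nndist] at h
    exact_mod_cast h
  · obtain ⟨y, hy, hxy⟩ := Metric.isCover_maximalSeparatedSet hfin (Set.mem_univ x)
    refine ⟨y, hTfin.mem_toFinset.2 hy, ?_⟩
    change edist x y ≤ ρ at hxy
    rw [edist_nndist] at hxy
    exact_mod_cast hxy

open Classical in
-- A maximal `4 r`-separated set has at least a constant times `r ^ (-s)` points, and the uniform
-- measure on it is added with weight `t`. The balls of radius `2 r` are disjoint, so at most half
-- of them have `ν`-mass at least `2 / N`. Around the other points the mixture has mass below `3 / N
-- ≤ r ^ a`, yet together they carry at least `t / 2 > r ^ η`.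
lemma dense_spreadOut [CompactSpace X] {s a η δ : ℝ} (has : a < s) (hη : 0 < η)
    (hδ : 0 < δ) (hX : ¬ BallNull s (Set.univ : Set X)) : Dense (spreadOut X a η δ) := by
  refine dense_of_mixture fun ν t ht => ?_
  unfold BallNull at hX
  push Not at hX
  obtain ⟨κ, hκ, hX⟩ := hX
  have hlim : ∀ e : ℝ, 0 < e → Tendsto (fun r : ℝ => r ^ e) (𝓝[>] 0) (𝓝 0) := fun e he => by
    have := (Real.continuousAt_rpow_const 0 e (Or.inr he.le)).tendsto
    rw [Real.zero_rpow he.ne'] at this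
    exact this.mono_left nhdsWithin_le_nhds
  obtain ⟨r, hrsa, hrη, hr0, hrκ, hrδ⟩ : ∃ r : ℝ, r ^ (s - a) < κ / (3 * 5 ^ s) ∧
      r ^ η < t / 2 ∧ 0 < r ∧ 5 * r < κ ∧ r < δ := by
    obtain ⟨r, ⟨h1, h2⟩, h3, h4⟩ := (((hlim (s - a) (sub_pos.2 has)).eventually
      (gt_mem_nhds (by positivity : 0 < κ / (3 * 5 ^ s)))).and
      ((hlim η hη).eventually (gt_mem_nhds (half_pos ht)))).and
      (Ioo_mem_nhdsGT (by positivity : 0 < min (κ / 5) δ)) |>.exists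
    refine ⟨r, h1, h2, h3, ?_, h4.trans_le (min_le_right _ _)⟩
    have := h4.trans_le (min_le_left _ _)
    rw [lt_div_iff₀ (by norm_num)] at this
    linarith
  obtain ⟨T, hsep, hcov⟩ := exists_finset_separated_cover X (by positivity : 0 < 4 * r)
  set N : ℝ := (T.card : ℝ) with hN
  -- The cover has closed balls of radius `4 r`; radius `5 r` makes them open, as `BallNull`
  -- requires.
  have hκN : κ ≤ N * (5 * r) ^ s := by
    refine (hX (T.image fun x => (x, 5 * r)) ?_ ?_).trans ?_
    · intro p hp
      obtain ⟨x, -, rfl⟩ := Finset.mem_image.1 hp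
      exact ⟨by positivity, hrκ⟩
    · intro x _
      obtain ⟨y, hy, hxy⟩ := hcov x
      refine Set.mem_biUnion (x := (y, 5 * r)) (Finset.mem_coe.2 (Finset.mem_image_of_mem _ hy)) ?_
      rw [Metric.mem_ball]
      dsimp only
      linarith
    · rw [Finset.sum_image fun x _ y _ h => (Prod.ext_iff.1 h).1]
      simp [hN]
  have hN0 : 0 < N := by
    by_contra! h
    have : 0 < (5 * r) ^ s := by positivity
    nlinarith
  have h3N : 3 / N ≤ r ^ a := by
    rw [div_le_iff₀ hN0]
    rw [Real.mul_rpow (by norm_num) hr0.le] at hκN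
    have h1 : r ^ s = r ^ (s - a) * r ^ a := by rw [← Real.rpow_add hr0, sub_add_cancel]
    rw [lt_div_iff₀ (by positivity)] at hrsa
    have h2 : 0 < N * r ^ a := by positivity
    have h3 : κ * 3 ≤ κ * (r ^ a * N) := by
      calc κ * 3 ≤ N * (5 ^ s * r ^ s) * 3 := by gcongr
        _ = (r ^ (s - a) * (3 * 5 ^ s)) * (N * r ^ a) := by rw [h1]; ring
        _ ≤ κ * (N * r ^ a) := by gcongr
        _ = κ * (r ^ a * N) := by ring
    exact le_of_mul_le_mul_left h3 hκ
  have hdisj : (T : Set X).PairwiseDisjoint fun x => Metric.closedBall x (2 * r) := by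
    intro x hx y hy hxy
    apply Metric.closedBall_disjoint_closedBall
    linarith [hsep x hx y hy hxy]
  obtain ⟨p, hp⟩ : ∃ p : X → Prop, ∀ x, p x ↔
      (ν : Measure X) (Metric.closedBall x (2 * r)) < ENNReal.ofReal (2 / N) := ⟨_, fun _ => Iff.rfl⟩
  have hbad : ((T.filter fun x => ¬ p x).card : ℝ) * (2 / N) ≤ 1 := by
    have h1 : ∑ x ∈ T.filter (fun x => ¬ p x), ENNReal.ofReal (2 / N) ≤ 1 := by
      calc _ ≤ ∑ x ∈ T.filter (fun x => ¬ p x), (ν : Measure X) (Metric.closedBall x (2 * r)) :=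
            Finset.sum_le_sum fun x hx => not_lt.1 ((hp x).not.1 (Finset.mem_filter.1 hx).2)
        _ = (ν : Measure X) (⋃ x ∈ T.filter (fun x => ¬ p x), Metric.closedBall x (2 * r)) :=
            (measure_biUnion_finset (hdisj.subset (Finset.coe_subset.2 (Finset.filter_subset _ _)))
              fun x _ => Metric.isClosed_closedBall.measurableSet).symm
        _ ≤ 1 := prob_le_one
    rw [Finset.sum_const, nsmul_eq_mul, ← ENNReal.ofReal_natCast,
      ← ENNReal.ofReal_mul (by positivity), ← ENNReal.ofReal_one,
      ENNReal.ofReal_le_ofReal_iff zero_le_one] at h1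
    exact h1
  have hcard : ((T.filter fun x => ¬ p x).card : ℝ) + (T.filter p).card = N := by
    rw [hN, add_comm]
    exact_mod_cast T.card_filter_add_card_filter_not p
  have hgood : 1 / 2 ≤ ((T.filter p).card : ℝ) * (1 / N) := by
    rw [mul_one_div, le_div_iff₀ hN0]
    rw [mul_div_assoc', div_le_one hN0] at hbad
    linarith
  have hw : ∀ x ∈ T, 0 ≤ (fun _ : X => 1 / N) x := fun x _ => by positivity
  have hsum1 : ∑ x ∈ T, (fun _ : X => 1 / N) x = 1 := by
    rw [Finset.sum_const, nsmul_eq_mul, ← hN, mul_one_div_cancel hN0.ne']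
  refine ⟨discreteProb T id (fun _ => 1 / N) hw hsum1, r, ⟨hr0, hrδ⟩, T.filter p, ?_, ?_⟩
  · intro x hx
    obtain ⟨hxT, hxp⟩ := Finset.mem_filter.1 hx
    have hσ : (discreteProb T id (fun _ => 1 / N) hw hsum1 : Measure X)
        (Metric.closedBall x (2 * r)) ≤ ENNReal.ofReal (1 / N) := by
      rw [discreteProb_apply _ _ _ _ _ _ Metric.isClosed_closedBall.measurableSet,
        Finset.sum_eq_single_of_mem x hxT fun y hy hyx => ?_]
      · refine mul_le_of_le_one_right (by simp) ?_
        exact Set.indicator_le_self' (by simp) _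
      · rw [Set.indicator_of_notMem, mul_zero]
        rw [Metric.mem_closedBall, not_le]
        have := hsep y hy x hxT hyx
        simp only [id]
        linarith
    calc _ ≤ 1 * (ν : Measure X) (Metric.closedBall x (2 * r)) +
          1 * (discreteProb T id (fun _ => 1 / N) hw hsum1 : Measure X)
            (Metric.closedBall x (2 * r)) := by
          rw [mixture_apply]
          gcongr
          · exact ENNReal.ofReal_le_one.2 (by linarith)
          · exact ENNReal.ofReal_le_one.2 t.2.2
      _ < ENNReal.ofReal (2 / N) + ENNReal.ofReal (1 / N) := by
          rw [one_mul, one_mul]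
          exact ENNReal.add_lt_add_of_lt_of_le (by simp) ((hp x).1 hxp) hσ
      _ = ENNReal.ofReal (3 / N) := by
          rw [← ENNReal.ofReal_add (by positivity) (by positivity)]
          congr 1
          ring
      _ ≤ _ := ENNReal.ofReal_le_ofReal h3N
  · have h1 := le_discreteProb_apply T id (fun _ => 1 / N) hw hsum1
      (⋃ x ∈ T.filter p, Metric.ball x r)
      (isOpen_biUnion fun x _ => Metric.isOpen_ball).measurableSet (T.filter p)
      (Finset.filter_subset _ _) fun x hx => Set.mem_biUnion hx (Metric.mem_ball_self hr0)
    rw [Finset.sum_const, nsmul_eq_mul] at h1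
    calc ENNReal.ofReal (r ^ η) < ENNReal.ofReal (t * (1 / 2)) := by
          rw [ENNReal.ofReal_lt_ofReal_iff (by positivity)]
          linarith
      _ = ENNReal.ofReal t * ENNReal.ofReal (1 / 2) := ENNReal.ofReal_mul t.2.1
      _ ≤ _ := by
          rw [mixture_apply]
          refine le_add_left ?_
          gcongr
          exact (ENNReal.ofReal_le_ofReal hgood).trans h1

end Spectrum

/-! ### Bounds on the spectrum, Legendre transform and dimension lower bound -/

section Spectrum

variable {X : Type*} [MetricSpace X] [MeasurableSpace X] [BorelSpace X]

lemma lowerLqSpectrum_one {X : Type*} [MetricSpace X] [MeasurableSpace X]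
    (μ : ProbabilityMeasure X) : lowerLqSpectrum (μ : Measure X) 1 = 0 := by
  simp [lowerLqSpectrum]

lemma mul_measure_le_lintegral {μ : Measure X} {f : X → ℝ≥0∞} {U : Set X} (hU : IsOpen U)
    {c : ℝ≥0∞} (h : ∀ x ∈ U, c ≤ f x) : c * μ U ≤ ∫⁻ x, f x ∂μ := by
  rw [← lintegral_indicator_const hU.measurableSet]
  refine lintegral_mono fun x => ?_
  by_cases hx : x ∈ U
  · simpa [hx] using h x hx
  · simp [hx]

/-- As `q - 1` is negative, small balls contribute large values: on the spread-out part the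
integrand is at least `r ^ (a (q - 1))`, and the mass of that part is at least `r ^ η` for small
scales. -/
lemma lowerLqSpectrum_le_of_forall_mem_spreadOut {a q η : ℝ} (hq : q < 1) (hη : 0 < η)
    {μ : ProbabilityMeasure X}
    (h : ∀ n : ℕ, μ ∈ spreadOut X a (1 / ((n : ℝ) + 1)) (1 / ((n : ℝ) + 1))) :
    lowerLqSpectrum (μ : Measure X) q ≤ ((η + a * (q - 1) : ℝ) : EReal) := by
  refine liminf_log_div_log_le
    (g := fun r => ∫⁻ x, ((μ : Measure X) (Metric.ball x r)) ^ (q - 1) ∂(μ : Measure X))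
    (frequently_nhdsGT_zero fun ε hε => ?_)
  obtain ⟨n, hn⟩ := exists_nat_one_div_lt (lt_min (lt_min hε hη) one_pos)
  obtain ⟨r, ⟨hr0, hrn⟩, T, hT, hμ⟩ := h n
  have hnε := hn.trans_le ((min_le_left _ _).trans (min_le_left _ _))
  have hnη := hn.trans_le ((min_le_left _ _).trans (min_le_right _ _))
  have hn1 := hn.trans_le (min_le_right _ _)
  refine ⟨r, hr0, hrn.trans hnε, ?_⟩
  calc ENNReal.ofReal (r ^ (η + a * (q - 1)))
      ≤ ENNReal.ofReal ((r ^ a) ^ (q - 1) * r ^ (1 / ((n : ℝ) + 1))) := by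
        apply ENNReal.ofReal_le_ofReal
        rw [← Real.rpow_mul hr0.le, ← Real.rpow_add hr0]
        exact Real.rpow_le_rpow_of_exponent_ge hr0 (hrn.trans hn1).le (by linarith)
    _ = ENNReal.ofReal (r ^ a) ^ (q - 1) * ENNReal.ofReal (r ^ (1 / ((n : ℝ) + 1))) := by
        rw [ENNReal.ofReal_mul (by positivity), ENNReal.ofReal_rpow_of_pos (by positivity)]
    _ ≤ ENNReal.ofReal (r ^ a) ^ (q - 1) * (μ : Measure X) (⋃ x ∈ T, Metric.ball x r) := by
        gcongr
    _ ≤ _ := by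
        refine mul_measure_le_lintegral (isOpen_biUnion fun x _ => Metric.isOpen_ball)
          fun x hx => ?_
        obtain ⟨y, hy, hxy⟩ := Set.mem_iUnion₂.1 hx
        have hle : (μ : Measure X) (Metric.ball x r) ≤ ENNReal.ofReal (r ^ a) := by
          refine (measure_mono ?_).trans (hT y hy).le
          refine Metric.ball_subset_closedBall.trans (Metric.closedBall_subset_closedBall' ?_)
          rw [Metric.mem_ball] at hxy
          linarith
        rw [← neg_sub 1 q, ENNReal.rpow_neg, ENNReal.rpow_neg]
        exact ENNReal.inv_le_inv.2 (ENNReal.rpow_le_rpow hle (by linarith))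

/-- One heavy ball suffices: the balls of radius `2 r` centred in `Metric.ball x r` contain it, so
the integral at scale `2 r` is at least its mass to the power `q`. The factor 2 in the exponent
absorbs the doubled radius, since `(2 r) ^ 2 ≤ r` for `r ≤ 1 / 4`. -/
lemma lowerLqSpectrum_le_of_lowerLocalDim_lt {q b : ℝ} (hq : 1 ≤ q) (hb : 0 < b)
    {μ : ProbabilityMeasure X} {x : X} (hx : lowerLocalDim (μ : Measure X) x < (b : EReal)) :
    lowerLqSpectrum (μ : Measure X) q ≤ ((2 * (b * q) : ℝ) : EReal) := by
  refine liminf_log_div_log_le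
    (g := fun r => ∫⁻ x, ((μ : Measure X) (Metric.ball x r)) ^ (q - 1) ∂(μ : Measure X))
    (frequently_nhdsGT_zero fun ε hε => ?_)
  obtain ⟨r, hr0, hrε, hr⟩ := exists_of_frequently_nhdsGT_zero
    (frequently_le_of_liminf_log_div_log_lt
      (g := fun r => (μ : Measure X) (Metric.ball x r)) hx)
    (by positivity : 0 < min (ε / 2) (1 / 4))
  have h1 := hrε.trans_le (min_le_left _ _)
  have h2 := hrε.trans_le (min_le_right _ _)
  have hbq : 0 < b * q := by positivity
  have hm : 0 < (μ : Measure X) (Metric.ball x r) :=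
    lt_of_lt_of_le (by simpa using Real.rpow_pos_of_pos hr0 b) hr
  refine ⟨2 * r, by positivity, by linarith, ?_⟩
  calc ENNReal.ofReal ((2 * r) ^ (2 * (b * q))) ≤ ENNReal.ofReal (r ^ (b * q)) := by
        apply ENNReal.ofReal_le_ofReal
        rw [Real.rpow_mul (by positivity)]
        refine Real.rpow_le_rpow (by positivity) ?_ hbq.le
        rw [Real.rpow_two]
        nlinarith
    _ = ENNReal.ofReal (r ^ b) ^ q := by
        rw [Real.rpow_mul hr0.le, ENNReal.ofReal_rpow_of_pos (by positivity)]
    _ ≤ ((μ : Measure X) (Metric.ball x r)) ^ q := ENNReal.rpow_le_rpow hr (by linarith)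
    _ = ((μ : Measure X) (Metric.ball x r)) ^ (q - 1) * (μ : Measure X) (Metric.ball x r) := by
        conv_rhs => rw [← ENNReal.rpow_one ((μ : Measure X) (Metric.ball x r)), ← ENNReal.rpow_mul,
          one_mul, ← ENNReal.rpow_add _ _ hm.ne' (measure_ne_top _ _), sub_add_cancel]
    _ ≤ _ := by
        refine mul_measure_le_lintegral Metric.isOpen_ball fun y hy => ?_
        refine ENNReal.rpow_le_rpow (measure_mono (Metric.ball_subset_ball' ?_)) (by linarith)
        rw [Metric.mem_ball, dist_comm] at hy
        linarith

lemma lowerLqSpectrum_nonpos {q : ℝ} (hq : 1 ≤ q) {μ : ProbabilityMeasure X}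
    (h : ∀ b : ℝ, 0 < b → ∃ x, lowerLocalDim (μ : Measure X) x < (b : EReal)) :
    lowerLqSpectrum (μ : Measure X) q ≤ 0 := by
  refine EReal.le_of_forall_lt_iff_le.1 fun c hc => ?_
  have hc0 : 0 < c := by exact_mod_cast hc
  have hq0 : 0 < q := by linarith
  obtain ⟨x, hx⟩ := h (c / (2 * q)) (by positivity)
  refine (lowerLqSpectrum_le_of_lowerLocalDim_lt hq (by positivity) hx).trans (le_of_eq ?_)
  congr 1
  field_simp

/-- If the `L^q`-spectrum lies below the line of slope `α` through `(1, 0)`, its Legendre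
transform at `α` is `α`. -/
lemma legendreTransform_lowerLqSpectrum {X : Type*} [MetricSpace X]
    [MeasurableSpace X] {α : ℝ} {μ : ProbabilityMeasure X}
    (h : ∀ q, lowerLqSpectrum (μ : Measure X) q ≤ (((q - 1) * α : ℝ) : EReal)) :
    legendreTransform (lowerLqSpectrum (μ : Measure X)) α = (α : EReal) := by
  refine le_antisymm ?_ (le_iInf fun q => ?_)
  · refine (iInf_le _ 1).trans (le_of_eq ?_)
    simp [lowerLqSpectrum_one]
  · calc (α : EReal) = ((q * α : ℝ) : EReal) - (((q - 1) * α : ℝ) : EReal) := by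
          rw [← EReal.coe_sub]
          congr 1
          ring
      _ ≤ _ := EReal.sub_le_sub le_rfl (h q)

/-- `E` lies in the union of the level set and the points of local dimension less than `α`. The
latter are `α`-null, and so would be a level set of dimension less than `α`. -/
lemma le_dimH_lowerLevelSet {α : ℝ} (hα : 0 < α) {μ : ProbabilityMeasure X} {E : Set X}
    (hE : μH[α] E ≠ 0) (h : ∀ x ∈ E, lowerLocalDim (μ : Measure X) x ≤ (α : EReal)) :
    ENNReal.ofReal α ≤ dimH (lowerLevelSet (μ : Measure X) α) := by
  by_contra! hlt
  have h0 := hausdorffMeasure_of_dimH_lt (d := α.toNNReal) hlt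
  rw [Real.coe_toNNReal _ hα.le] at h0
  refine hE (measure_mono_null (fun x hx => ?_)
    (measure_union_null h0 (hausdorffMeasure_lowerLocalDim_lt_self (μ : Measure X) hα)))
  exact (h x hx).eq_or_lt

end Spectrum

end Multifractal

end

theorem theorem6p1 (d : ℕ) (K : Set (EuclideanSpace ℝ (Fin d))) (hK : IsCompact K) :
    Multifractal.Typical (fun μ : ProbabilityMeasure K =>
      ∀ α : ℝ, 0 ≤ α → ENNReal.ofReal α < dimH K →
        ((dimH (Multifractal.lowerLevelSet (μ : Measure K) α) : ENNReal) : EReal) =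
          Multifractal.legendreTransform (Multifractal.lowerLqSpectrum (μ : Measure K)) α) := by
  have : CompactSpace K := isCompact_iff_compactSpace.1 hK
  have hdim : dimH (Set.univ : Set K) = dimH K := by
    rw [← (isometry_subtype_coe (s := K)).dimH_image, Set.image_univ, Subtype.range_coe]
  obtain ⟨ι, _, F, b, hF, hfam⟩ := Multifractal.exists_countable_family hK
  let J := {a : ℚ // 0 < (a : ℝ) ∧ ENNReal.ofReal a < dimH (Set.univ : Set K)}
  let O : (ι × ℕ) ⊕ (J × ℕ) → Set (ProbabilityMeasure K) :=
    Sum.elim (fun i => Multifractal.heavyCover (F i.1) (b i.1) (1 / ((i.2 : ℝ) + 1)))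
      (fun j => Multifractal.spreadOut K (j.1 : ℚ) (1 / ((j.2 : ℝ) + 1)) (1 / ((j.2 : ℝ) + 1)))
  refine Multifractal.typical_of_forall_mem (O := O) ?_ ?_ fun μ hμ α hα0 hα => ?_
  · rintro (i | j)
    · exact Multifractal.isOpen_heavyCover _ _ _
    · exact Multifractal.isOpen_spreadOut _ _ _
  · rintro (i | j)
    · exact Multifractal.dense_heavyCover (hF i.1).2.2 (by positivity)
    · obtain ⟨s, hs, hsd⟩ := Multifractal.exists_real_btwn j.1.2.2
      have hs0 : 0 < s := j.1.2.1.trans hs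
      exact Multifractal.dense_spreadOut hs (by positivity) (by positivity)
        (Multifractal.not_ballNull_of_lt_dimH hs0 hsd)
  rw [← hdim] at hα
  have hheavy : ∀ i (n : ℕ), μ ∈ Multifractal.heavyCover (F i) (b i) (1 / ((n : ℝ) + 1)) :=
    fun i n => hμ (Sum.inl (i, n))
  have hspread : ∀ (j : J) (n : ℕ), μ ∈ Multifractal.spreadOut K (j : ℚ) (1 / ((n : ℝ) + 1))
      (1 / ((n : ℝ) + 1)) := fun j n => hμ (Sum.inr (j, n))
  clear hμ
  have hlocal : ∀ α : ℝ, 0 < α → ENNReal.ofReal α < dimH (Set.univ : Set K) →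
      ∃ E : Set K, μH[α] E ≠ 0 ∧
        ∀ x ∈ E, Multifractal.lowerLocalDim (μ : Measure K) x ≤ (α : EReal) := by
    intro α hα hαd
    obtain ⟨E, hE, hEF⟩ := hfam α hα hαd
    refine ⟨E, hE, fun x hx => EReal.le_of_forall_lt_iff_le.1 fun β hβ => ?_⟩
    obtain ⟨i, hi, hEi⟩ := hEF β (by exact_mod_cast hβ)
    refine (Multifractal.lowerLocalDim_le_of_forall_mem_heavyCover
      (hheavy i) (hEi hx)).trans ?_
    exact_mod_cast hi.le
  have hupper : ∀ q, Multifractal.lowerLqSpectrum (μ : Measure K) q ≤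
      (((q - 1) * α : ℝ) : EReal) := by
    obtain ⟨s, hs, hsd⟩ := Multifractal.exists_real_btwn hα
    intro q
    rcases lt_or_ge q 1 with hq | hq
    · obtain ⟨a, ha1, ha2⟩ := exists_rat_btwn hs
      have haJ : 0 < (a : ℝ) ∧ ENNReal.ofReal a < dimH (Set.univ : Set K) :=
        ⟨hα0.trans_lt ha1, (ENNReal.ofReal_le_ofReal ha2.le).trans_lt hsd⟩
      -- This is exactly the slack for which `η + a * (q - 1) = (q - 1) * α`.
      have hη : 0 < (a - α) * (1 - q) := mul_pos (sub_pos.2 ha1) (sub_pos.2 hq)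
      refine (Multifractal.lowerLqSpectrum_le_of_forall_mem_spreadOut hq hη
        (hspread ⟨a, haJ⟩)).trans (le_of_eq ?_)
      congr 1
      ring
    · refine (Multifractal.lowerLqSpectrum_nonpos hq fun c hc => ?_).trans ?_
      · have hs0 : 0 < s := hα0.trans_lt hs
        have hm : 0 < min (c / 2) s := by positivity
        obtain ⟨E, hE, hEl⟩ := hlocal (min (c / 2) s) hm
          ((ENNReal.ofReal_le_ofReal (min_le_right _ _)).trans_lt hsd)
        obtain ⟨x, hx⟩ := nonempty_of_measure_ne_zero hE
        refine ⟨x, (hEl x hx).trans_lt ?_⟩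
        have : min (c / 2) s < c := (min_le_left _ _).trans_lt (by linarith)
        exact_mod_cast this
      · have : 0 ≤ (q - 1) * α := mul_nonneg (by linarith) hα0
        exact_mod_cast this
  rw [Multifractal.legendreTransform_lowerLqSpectrum hupper]
  have hdimE : dimH (Multifractal.lowerLevelSet (μ : Measure K) α) = ENNReal.ofReal α := by
    refine le_antisymm (Multifractal.dimH_lowerLevelSet_le (μ : Measure K) hα0) ?_
    -- At `α = 0` the lower bound is trivial, and the level set may even be empty.
    rcases hα0.eq_or_lt with rfl | hα0
    · simp
    · obtain ⟨E, hE, hEl⟩ := hlocal α hα0 hα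
      exact Multifractal.le_dimH_lowerLevelSet hα0 hE hEl
  rw [hdimE, EReal.coe_ennreal_ofReal, max_eq_left hα0]
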